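/- Let $(\mathcal W,\Sigma_{\mathcal W})$ and $(\mathcal Z,\Sigma_{\mathcal Z})$ be measurable spaces, $\mu$ a probability measure on $\mathcal Z$, $\ell:\mathcal W\times\mathcal Z\to[0,\infty)$ a jointly measurable loss, $n>1$, and $S_n=(Z_1,\dots,Z_n)$ an i.i.d. sample from $\mu$. A (randomized) statistical learning algorithm $\mathcal A$ maps a sample $S_n$ to a probability distribution $P_{W_n|S_n}$ on $\mathcal W$, the conditional law of its output $W_n$; its expected generalization error given the sample is $$\overline{\mathrm{gen}}(W_n,S_n)=\int_{\mathcal W}\Big(\mathbb E_{Z'\sim\mu}[\ell(w,Z')]-\frac1n\sum_{t=1}^n\ell(w,Z_t)\Big)\,dP_{W_n|S_n}(w).$$ For a probability measure $P_1$ on $\mathcal W$, put $\|P-P_1\|_{p,P_1}=\big(\int_{\mathcal W}\big|\frac{dP}{dP_1}-1\big|^p\,dP_1\big)^{1/p}$ if $P\ll P_1$ and $\|P-P_1\|_{p,P_1}=\infty$ otherwise, and $\|f\|_{q,P_1,*}=\big(\int_{\mathcal W}|f|^q\,dP_1\big)^{1/q}\in[0,\infty]$. (A bound whose right-hand side is $\infty$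 holds trivially.) Fix $p>1$ and $q$ with $1/p+1/q=1$, and suppose that for some $B>0$ $$\sup_{w\in\mathcal W}\mathbb E_{Z'\sim\mu}\big[\ell(w,Z')^{\min\{2,q\}}\big]\le B^{\min\{2,q\}}.$$ Then for any $P_1$, any $\eta>0$, any $n>1$ and any $\delta\in(0,1)$, with probability at least $1-\delta$ over $S_n$, all statistical learning algorithms $W_n=\mathcal A(S_n)$ simultaneously satisfy the following bounds. (a) If $p\in(1,2]$, then $$\overline{\mathrm{gen}}(W_n,S_n)\le\frac{\|P_{W_n|S_n}-P_1\|_{p,P_1}^2}{\eta n}+\frac{\eta}{(p-1)n}\sum_{t=1}^n\|\ell(\cdot,Z_t)\|_{q,P_1,*}^2+\sqrt{\frac{2B^2\log(1/\delta)}{n}}.$$ (b) If $p\ge2$, then $$\overline{\mathrm{gen}}(W_n,S_n)\le\frac{\|P_{W_n|S_n}-P_1\|_{p,P_1}^p}{\eta n}+\frac{2}{qn}\Big(\frac{\eta}{2p}\Big)^{q-1}\sum_{t=1}^n\|\ell(\cdot,Z_t)\|_{q,P_1,*}^q+2B\Big(\frac{\log(1/\delta)}{n}\Big)^{1-1/q}.$$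 -/

import Mathlib

open MeasureTheory
open scoped ENNReal

noncomputable section

namespace OnlineToPAC

variable {W Z : Type*} [MeasurableSpace W] [MeasurableSpace Z]

/-- The risk (test error) `E[ℓ(w, Z')]`, `Z' ∼ μ`, of a hypothesis `w`. -/
def risk (ℓ : W → Z → ℝ) (μ : Measure Z) (w : W) : ℝ :=
  ∫ z, ℓ w z ∂μ

/-- The empirical risk `L(w, S) = (1/n) ∑ ℓ(w, Z_t)` of a hypothesis `w` on a sample `S`. -/
def empRisk {n : ℕ} (ℓ : W → Z → ℝ) (S : Fin n → Z) (w : W) : ℝ :=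
  (1 / (n : ℝ)) * ∑ t, ℓ w (S t)

/-- The generalization error `gen(w, S)` of a hypothesis `w`. -/
def gen {n : ℕ} (ℓ : W → Z → ℝ) (μ : Measure Z) (S : Fin n → Z) (w : W) : ℝ :=
  risk ℓ μ w - empRisk ℓ S w

/-- A randomized statistical learning algorithm: it maps a sample `S` to the conditional
distribution of its output given `S`. -/
abbrev LearningAlgorithm (n : ℕ) (W Z : Type*) [MeasurableSpace W] : Type _ :=
  (Fin n → Z) → ProbabilityMeasure W

/-- The conditional expectation `E[gen(W_n, S_n) | S_n = S]` of the generalization error of the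
algorithm `A`, over the randomization of its output. -/
def genBar {n : ℕ} (ℓ : W → Z → ℝ) (μ : Measure Z) (A : LearningAlgorithm n W Z)
    (S : Fin n → Z) : ℝ :=
  ∫ w, gen ℓ μ S w ∂(A S : Measure W)

open Classical in
/-- The weighted `p`-norm distance `‖P - P'‖_{p,P₁}`: the `L_p(P₁)` distance of the
Radon-Nikodym derivatives with respect to `P₁`, and `∞` where these do not exist. -/
def lpDist (p : ℝ) (P₁ P P' : Measure W) : ℝ≥0∞ :=
  if P ≪ P₁ ∧ P' ≪ P₁ then
    eLpNorm (fun w => (P.rnDeriv P₁ w).toReal - (P'.rnDeriv P₁ w).toReal) (ENNReal.ofReal p) P₁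
  else ∞

/-- The dual norm `‖f‖_{q,P₁,*} = (∫ |f|^q dP₁)^{1/q}`. -/
def dualNorm (q : ℝ) (P₁ : Measure W) (f : W → ℝ) : ℝ≥0∞ :=
  eLpNorm f (ENNReal.ofReal q) P₁

end OnlineToPAC

end

set_option linter.unusedSectionVars false

/-! The proof is an online-to-PAC conversion. A posterior `P ≪ P₁` is identified with its density
`g` in `L^p(P₁)`. Let `ρ` be the functional on `L^p` given by integration against the risk, and `ψ
z` the one given by integration against `ℓ(·, z)`. Then `n` times the expected generalization error
is `φ g` with `φ = ∑ (ρ - ψ (Z_t))`. With the regularizer `‖g - 1‖ ^ r / η` and the potential `Ψ φ =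
sup_g (φ g - ‖g - 1‖ ^ r / η)` over densities, `φ g ≤ ‖g - 1‖ ^ r / η + Ψ φ` for every `g` at once.
This gives simultaneity over all algorithms, and only `Ψ φ` has to be controlled, with high
probability.

Stability: since `‖·‖ ^ r` is uniformly convex, adding `ρ - ψ` to the argument of `Ψ` costs at most
`(ρ - ψ) g + K ‖ψ‖ ^ r'` for a near-maximizer `g` chosen before `ψ` is seen
(`exists_potential_add_sub_le`). The known part `ρ` does not enter the penalty. Here `r = 2` for `p
≤ 2` (Ball-Carlen-Lieb, from Gross' two-point inequality) and `r = p` for `p ≥ 2` (a Bregman bound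
for `|·| ^ p`).

Concentration: a nonnegative loss with bounded moment of order `m = min 2 q` satisfies `E exp (λ (E
X - X)) ≤ exp (κ λ ^ m B ^ m)`, because `exp (-y) ≤ 1 - y + κ y ^ m` for `y ≥ 0`; Jensen and Tonelli
carry this over to densities. Hence `exp (λ (Ψ - K ∑ ‖ψ‖ ^ r'))` is a supermartingale up to a
constant factor per step. Markov's inequality and the optimal `λ` finish the proof.

Measurability of `Ψ` needs a separable `L^p`; this is arranged by passing to a countably generated
sub-σ-algebra of `W` that still makes `ℓ` jointly measurable. -/

namespace OnlineToPAC

/-! ### Scalar inequalities: Young, two-point convexity, Bregman bounds -/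

section RealInequalities

/-- Young's inequality after scaling `u` by `(p * c) ^ (1 / p)` and `a` by its inverse, so that the
`u` term becomes exactly `c * u ^ p`. -/
theorem mul_le_rpow_add_rpow {p q : ℝ} (hpq : p.HolderConjugate q) {u a c : ℝ} (hu : 0 ≤ u)
    (ha : 0 ≤ a) (hc : 0 < c) :
    a * u ≤ c * u ^ p + 1 / q * (1 / (p * c)) ^ (q - 1) * a ^ q := by
  have hp : 0 < p := hpq.pos
  have hq : 0 < q := hpq.symm.pos
  have hk : 0 < p * c := mul_pos hp hc
  have hs : 0 < (p * c) ^ (1 / p) := Real.rpow_pos_of_pos hk _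
  have h := Real.young_inequality_of_nonneg (mul_nonneg hs.le hu) (div_nonneg ha hs.le) hpq
  have e1 : ((p * c) ^ (1 / p) * u) ^ p / p = c * u ^ p := by
    rw [Real.mul_rpow hs.le hu, ← Real.rpow_mul hk.le, one_div_mul_cancel hp.ne', Real.rpow_one]
    field_simp
  have e2 : (a / (p * c) ^ (1 / p)) ^ q / q = 1 / q * (1 / (p * c)) ^ (q - 1) * a ^ q := by
    have : (1 / p) * q = q - 1 := by
      have := hpq.div_conj_eq_sub_one
      have h2 := hpq.symm.div_conj_eq_sub_one
      rw [← h2]; ring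
    rw [Real.div_rpow ha hs.le, ← Real.rpow_mul hk.le, this, one_div (p * c),
      Real.inv_rpow hk.le]
    ring
  rw [e1, e2] at h
  calc a * u = (p * c) ^ (1 / p) * u * (a / (p * c) ^ (1 / p)) := by field_simp
    _ ≤ _ := h

/-- AM-GM: the product of the two terms is `(1 - t ^ 2) ^ a`, which is at least `1` because `a ≤ 0`.
-/
theorem two_le_rpow_add_rpow {a t : ℝ} (ha : a ≤ 0) (ht0 : 0 ≤ t) (ht1 : t < 1) :
    2 ≤ (1 + t) ^ a + (1 - t) ^ a := by
  have h1 : 0 < (1 + t) ^ a := Real.rpow_pos_of_pos (by linarith) _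
  have h2 : 0 < (1 - t) ^ a := Real.rpow_pos_of_pos (by linarith) _
  have h3 : 1 ≤ (1 + t) ^ a * (1 - t) ^ a := by
    rw [← Real.mul_rpow (by linarith) (by linarith)]
    exact Real.one_le_rpow_of_pos_of_le_one_of_nonpos (by nlinarith) (by nlinarith) ha
  nlinarith [sq_nonneg ((1 + t) ^ a - (1 - t) ^ a)]

theorem hasDerivAt_one_add_rpow {t s : ℝ} (ht : 0 < 1 + t) :
    HasDerivAt (fun x : ℝ => (1 + x) ^ s) (s * (1 + t) ^ (s - 1)) t := by
  have := (((hasDerivAt_id t).const_add 1).rpow_const (p := s) (Or.inl ht.ne'))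
  simpa using this

theorem hasDerivAt_one_sub_rpow {t s : ℝ} (ht : 0 < 1 - t) :
    HasDerivAt (fun x : ℝ => (1 - x) ^ s) (-(s * (1 - t) ^ (s - 1))) t := by
  have := (((hasDerivAt_id t).const_sub 1).rpow_const (p := s) (Or.inl ht.ne'))
  simpa using this

/-- Equality holds at `t = 0`. Differentiating the difference twice leaves a positive multiple of
`(1 + t) ^ (p - 2) + (1 - t) ^ (p - 2) - 2`, nonnegative since `p ≤ 2`. -/
theorem two_add_le_one_add_rpow_add_one_sub_rpow {p t : ℝ} (hp1 : 1 < p) (hp2 : p ≤ 2)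
    (ht0 : 0 ≤ t) (ht1 : t ≤ 1) :
    2 + p * (p - 1) * t ^ 2 ≤ (1 + t) ^ p + (1 - t) ^ p := by
  have cont : ∀ s : ℝ, 0 < s →
      Continuous (fun x : ℝ => (1 + x) ^ s) ∧ Continuous (fun x : ℝ => (1 - x) ^ s) := fun s hs =>
    ⟨Continuous.rpow_const (by fun_prop) fun _ => Or.inr hs.le,
      Continuous.rpow_const (by fun_prop) fun _ => Or.inr hs.le⟩
  have hk : ∀ x ∈ Set.Icc (0 : ℝ) 1,
      0 ≤ (1 + x) ^ (p - 1) - (1 - x) ^ (p - 1) - 2 * (p - 1) * x := by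
    have hd : ∀ x ∈ Set.Ioo (0 : ℝ) 1, HasDerivAt
        (fun x : ℝ => (1 + x) ^ (p - 1) - (1 - x) ^ (p - 1) - 2 * (p - 1) * x)
        ((p - 1) * (1 + x) ^ (p - 1 - 1) - (-((p - 1) * (1 - x) ^ (p - 1 - 1)))
          - 2 * (p - 1)) x := fun x hx => by
      have h3 : HasDerivAt (fun x : ℝ => 2 * (p - 1) * x) (2 * (p - 1)) x := by
        simpa using (hasDerivAt_id x).const_mul (2 * (p - 1))
      exact ((hasDerivAt_one_add_rpow (by linarith [hx.1])).sub
        (hasDerivAt_one_sub_rpow (by linarith [hx.2]))).sub h3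
    have hm : MonotoneOn (fun x : ℝ => (1 + x) ^ (p - 1) - (1 - x) ^ (p - 1) - 2 * (p - 1) * x)
        (Set.Icc 0 1) := by
      refine monotoneOn_of_deriv_nonneg (convex_Icc 0 1) ?_ ?_ ?_
      · have := cont (p - 1) (by linarith)
        exact (((this.1.sub this.2).sub (by fun_prop))).continuousOn
      · rw [interior_Icc]
        exact fun x hx => (hd x hx).differentiableAt.differentiableWithinAt
      · rw [interior_Icc]
        intro x hx
        rw [(hd x hx).deriv]
        have := two_le_rpow_add_rpow (a := p - 1 - 1) (by linarith) hx.1.le hx.2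
        nlinarith
    intro x hx
    have := hm (Set.left_mem_Icc.2 zero_le_one) hx hx.1
    simpa using this
  have hd : ∀ x ∈ Set.Ioo (0 : ℝ) 1, HasDerivAt
      (fun x : ℝ => (1 + x) ^ p + (1 - x) ^ p - p * (p - 1) * x ^ 2)
      (p * (1 + x) ^ (p - 1) + (-(p * (1 - x) ^ (p - 1))) - p * (p - 1) * (2 * x)) x :=
    fun x hx => by
      have h3 : HasDerivAt (fun x : ℝ => p * (p - 1) * x ^ 2) (p * (p - 1) * (2 * x)) x := by
        simpa using (hasDerivAt_pow 2 x).const_mul (p * (p - 1))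
      exact ((hasDerivAt_one_add_rpow (by linarith [hx.1])).add
        (hasDerivAt_one_sub_rpow (by linarith [hx.2]))).sub h3
  have hm : MonotoneOn (fun x : ℝ => (1 + x) ^ p + (1 - x) ^ p - p * (p - 1) * x ^ 2)
      (Set.Icc 0 1) := by
    refine monotoneOn_of_deriv_nonneg (convex_Icc 0 1) ?_ ?_ ?_
    · have := cont p (by linarith)
      exact (((this.1.add this.2).sub (by fun_prop))).continuousOn
    · rw [interior_Icc]
      exact fun x hx => (hd x hx).differentiableAt.differentiableWithinAt
    · rw [interior_Icc]
      intro x hx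
      rw [(hd x hx).deriv]
      have := hk x ⟨hx.1.le, hx.2.le⟩
      nlinarith
  have := hm (Set.left_mem_Icc.2 zero_le_one) ⟨ht0, ht1⟩ ht0
  norm_num at this
  linarith

theorem one_add_rpow_le_of_le_one {s θ : ℝ} (hs : -1 ≤ s) (hθ0 : 0 ≤ θ) (hθ1 : θ ≤ 1) :
    (1 + s) ^ θ ≤ 1 + θ * s := rpow_one_add_le_one_add_mul_self hs hθ0 hθ1

theorem sq_add_mul_sq_rpow_le_of_nonneg {p m d : ℝ} (hp1 : 1 < p) (hp2 : p ≤ 2) (hm : 0 ≤ m)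
    (hd : 0 ≤ d) :
    (m ^ 2 + (p - 1) * d ^ 2) ^ (p / 2) ≤ (|m + d| ^ p + |m - d| ^ p) / 2 := by
  have hsq : ∀ x : ℝ, 0 ≤ x → (x ^ 2) ^ (p / 2) = x ^ p := fun x hx => by
    rw [← Real.rpow_natCast x 2, ← Real.rpow_mul hx]; congr 1; push_cast; ring
  rcases le_total d m with hdm | hmd
  · rcases hm.eq_or_lt with rfl | hm0
    · have : d = 0 := le_antisymm hdm hd
      subst this
      simp [Real.zero_rpow (show p / 2 ≠ 0 by linarith), Real.zero_rpow (show p ≠ 0 by linarith)]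
    obtain ⟨t, rfl⟩ : ∃ t, d = m * t := ⟨d / m, by field_simp⟩
    have ht0 : 0 ≤ t := nonneg_of_mul_nonneg_right hd hm0
    have ht1 : t ≤ 1 := le_of_mul_le_mul_left (by linarith) hm0
    have h1 := two_add_le_one_add_rpow_add_one_sub_rpow hp1 hp2 ht0 ht1
    have h2 := one_add_rpow_le_of_le_one (s := (p - 1) * t ^ 2) (θ := p / 2)
      (by nlinarith [sq_nonneg t]) (by linarith) (by linarith)
    have e1 : m ^ 2 + (p - 1) * (m * t) ^ 2 = m ^ 2 * (1 + (p - 1) * t ^ 2) := by ring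
    have e2 : m + m * t = m * (1 + t) := by ring
    have e3 : m - m * t = m * (1 - t) := by ring
    rw [e1, e2, e3, abs_of_nonneg (mul_nonneg hm (by linarith)),
      abs_of_nonneg (mul_nonneg hm (by linarith)), Real.mul_rpow (by positivity)
      (by nlinarith [sq_nonneg t]), Real.mul_rpow hm (by linarith),
      Real.mul_rpow hm (by linarith), hsq m hm]
    have h3 : 0 ≤ m ^ p := Real.rpow_nonneg hm _
    nlinarith
  · rcases hd.eq_or_lt with rfl | hd0
    · have : m = 0 := le_antisymm hmd hm
      subst this
      simp [Real.zero_rpow (show p / 2 ≠ 0 by linarith), Real.zero_rpow (show p ≠ 0 by linarith)]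
    obtain ⟨t, rfl⟩ : ∃ t, m = d * t := ⟨m / d, by field_simp⟩
    have ht0 : 0 ≤ t := nonneg_of_mul_nonneg_right hm hd0
    have ht1 : t ≤ 1 := le_of_mul_le_mul_left (by linarith) hd0
    have h1 := two_add_le_one_add_rpow_add_one_sub_rpow hp1 hp2 ht0 ht1
    have h2 := one_add_rpow_le_of_le_one (s := p - 2 + t ^ 2) (θ := p / 2)
      (by nlinarith [sq_nonneg t]) (by linarith) (by linarith)
    have e1 : (d * t) ^ 2 + (p - 1) * d ^ 2 = d ^ 2 * (1 + (p - 2 + t ^ 2)) := by ring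
    have e2 : d * t + d = d * (1 + t) := by ring
    have e3 : |d * t - d| = d * (1 - t) := by
      rw [show d * t - d = -(d * (1 - t)) by ring, abs_neg,
        abs_of_nonneg (mul_nonneg hd (by linarith))]
    rw [e1, e2, e3, abs_of_nonneg (mul_nonneg hd (by linarith)), Real.mul_rpow (by positivity)
      (by nlinarith [sq_nonneg t]), Real.mul_rpow hd (by linarith),
      Real.mul_rpow hd (by linarith), hsq d hd]
    have h3 : 0 ≤ d ^ p := Real.rpow_nonneg hd _
    -- With `d` the larger variable, the Bernoulli bound falls below the second-order bound by `p /
    -- 2 * (2 - p) * (1 - t ^ 2)`.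
    have h4 : 1 + p / 2 * (p - 2 + t ^ 2) ≤ ((1 + t) ^ p + (1 - t) ^ p) / 2 := by
      have : p / 2 * (p - 2) * (1 - t ^ 2) ≤ 0 :=
        mul_nonpos_of_nonpos_of_nonneg (by nlinarith) (by nlinarith)
      nlinarith
    nlinarith

/-- Gross' two-point inequality. -/
theorem sq_add_mul_sq_rpow_le {p : ℝ} (hp1 : 1 < p) (hp2 : p ≤ 2) (m d : ℝ) :
    (m ^ 2 + (p - 1) * d ^ 2) ^ (p / 2) ≤ (|m + d| ^ p + |m - d| ^ p) / 2 := by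
  have h := sq_add_mul_sq_rpow_le_of_nonneg hp1 hp2 (abs_nonneg m) (abs_nonneg d)
  rw [sq_abs, sq_abs] at h
  refine h.trans_eq ?_
  rcases abs_choice m with hm | hm <;> rcases abs_choice d with hd | hd <;> rw [hm, hd]
  · rw [← sub_eq_add_neg, sub_neg_eq_add, add_comm]
  · rw [show -m + d = -(m - d) by ring, show -m - d = -(m + d) by ring, abs_neg, abs_neg, add_comm]
  · rw [show -m + -d = -(m + d) by ring, show -m - -d = -(m - d) by ring, abs_neg, abs_neg]

theorem rpow_sub_two_mul_self {p x : ℝ} (hp : 1 < p) (hx : 0 ≤ x) :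
    x ^ (p - 2) * x = x ^ (p - 1) := by
  rcases hx.eq_or_lt with rfl | hx
  · rw [mul_zero, Real.zero_rpow (by linarith)]
  · rw [← Real.rpow_add_one hx.ne']; ring_nf

theorem add_rpow_le_two_rpow_mul {s a b : ℝ} (hs : 1 ≤ s) (ha : 0 ≤ a) (hb : 0 ≤ b) :
    2 ^ (1 - s) * (a + b) ^ s ≤ a ^ s + b ^ s := by
  have h := NNReal.rpow_add_le_mul_rpow_add_rpow ⟨a, ha⟩ ⟨b, hb⟩ hs
  have h' : (a + b) ^ s ≤ 2 ^ (s - 1) * (a ^ s + b ^ s) := by exact_mod_cast h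
  have h2 : (0 : ℝ) < 2 ^ (s - 1) := by positivity
  rw [show 1 - s = -(s - 1) by ring, Real.rpow_neg (by norm_num), inv_mul_le_iff₀ h2]
  exact h'

/-- If `x` and `x + u` have the same sign this is superadditivity of `t ^ (p - 1)`. If zero lies
between them it is the power mean inequality, extremal at `x = -u / 2`, and this case dictates `2 ^
(2 - p)`. -/
theorem mul_rpow_le_signed_rpow_sub {p x u : ℝ} (hp : 2 ≤ p) (hu : 0 ≤ u) :
    2 ^ (2 - p) * u ^ (p - 1) ≤ |x + u| ^ (p - 2) * (x + u) - |x| ^ (p - 2) * x := by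
  have h21 : (2 : ℝ) ^ (2 - p) ≤ 1 :=
    Real.rpow_le_one_of_one_le_of_nonpos (by norm_num) (by linarith)
  have hu' : 0 ≤ u ^ (p - 1) := Real.rpow_nonneg hu _
  have hpos : ∀ y : ℝ, 0 ≤ y → |y| ^ (p - 2) * y = y ^ (p - 1) := fun y hy => by
    rw [abs_of_nonneg hy, rpow_sub_two_mul_self (by linarith) hy]
  have hneg : ∀ y : ℝ, y ≤ 0 → |y| ^ (p - 2) * y = -(-y) ^ (p - 1) := fun y hy => by
    rw [← rpow_sub_two_mul_self (by linarith) (by linarith : 0 ≤ -y), abs_of_nonpos hy]; ring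
  rcases le_total 0 x with hx | hx
  · rw [hpos x hx, hpos _ (by linarith)]
    have := Real.add_rpow_le_rpow_add hx hu (by linarith : 1 ≤ p - 1)
    nlinarith
  · rcases le_total 0 (x + u) with hxu | hxu
    · rw [hpos _ hxu, hneg x hx]
      have := add_rpow_le_two_rpow_mul (by linarith : 1 ≤ p - 1) hxu (by linarith : 0 ≤ -x)
      rw [show 1 - (p - 1) = 2 - p by ring, show x + u + -x = u by ring] at this
      linarith
    · rw [hneg _ hxu, hneg x hx]
      have := Real.add_rpow_le_rpow_add (by linarith : 0 ≤ -(x + u)) hu (by linarith : 1 ≤ p - 1)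
      rw [show -(x + u) + u = -x by ring] at this
      nlinarith

/-- The two sides agree at `u = 0`, and `mul_rpow_le_signed_rpow_sub` compares their derivatives in
`u`. -/
theorem abs_rpow_bregman_of_nonneg {p x u : ℝ} (hp : 2 ≤ p) (hu : 0 ≤ u) :
    |x| ^ p + p * |x| ^ (p - 2) * x * u + 2 ^ (2 - p) * u ^ p ≤ |x + u| ^ p := by
  have hd : ∀ v ∈ Set.Ioi (0 : ℝ), HasDerivAt
      (fun v : ℝ => |x + v| ^ p - p * |x| ^ (p - 2) * x * v - 2 ^ (2 - p) * v ^ p)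
      (p * |x + v| ^ (p - 2) * (x + v) - p * |x| ^ (p - 2) * x
        - 2 ^ (2 - p) * (p * v ^ (p - 1))) v := fun v hv => by
    have h1 : HasDerivAt (fun v : ℝ => |x + v| ^ p) (p * |x + v| ^ (p - 2) * (x + v)) v := by
      simpa using (hasDerivAt_abs_rpow (x + v) (by linarith : 1 < p)).comp_const_add x v
    have h2 : HasDerivAt (fun v : ℝ => p * |x| ^ (p - 2) * x * v) (p * |x| ^ (p - 2) * x) v := by
      simpa using (hasDerivAt_id v).const_mul (p * |x| ^ (p - 2) * x)
    exact (h1.sub h2).sub ((Real.hasDerivAt_rpow_const (Or.inl (ne_of_gt hv))).const_mul _)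
  have hm : MonotoneOn
      (fun v : ℝ => |x + v| ^ p - p * |x| ^ (p - 2) * x * v - 2 ^ (2 - p) * v ^ p)
      (Set.Ici 0) := by
    refine monotoneOn_of_deriv_nonneg (convex_Ici 0) ?_ ?_ ?_
    · have h1 : Continuous (fun v : ℝ => |x + v| ^ p) :=
        Continuous.rpow_const (by fun_prop) fun _ => Or.inr (by linarith)
      have h2 : Continuous (fun v : ℝ => v ^ p) :=
        Continuous.rpow_const (by fun_prop) fun _ => Or.inr (by linarith)
      exact ((h1.sub (by fun_prop)).sub (h2.const_mul _)).continuousOn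
    · rw [interior_Ici]
      exact fun v hv => (hd v hv).differentiableAt.differentiableWithinAt
    · rw [interior_Ici]
      intro v hv
      rw [(hd v hv).deriv]
      have := mul_rpow_le_signed_rpow_sub (x := x) hp (le_of_lt hv)
      nlinarith
  have := hm Set.self_mem_Ici hu hu
  simp only [add_zero, mul_zero, sub_zero, Real.zero_rpow (show p ≠ 0 by linarith)] at this
  linarith

/-- Uniform convexity of `|·|^p` for `p ≥ 2`, in the form of a lower bound on the Bregman
divergence with the optimal constant. -/
theorem abs_rpow_bregman {p : ℝ} (hp : 2 ≤ p) (x u : ℝ) :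
    |x| ^ p + p * |x| ^ (p - 2) * x * u + 2 ^ (2 - p) * |u| ^ p ≤ |x + u| ^ p := by
  rcases le_total 0 u with hu | hu
  · rw [abs_of_nonneg hu]; exact abs_rpow_bregman_of_nonneg hp hu
  · have h := abs_rpow_bregman_of_nonneg (x := -x) hp (neg_nonneg.2 hu)
    rw [abs_neg, show -x + -u = -(x + u) by ring, abs_neg] at h
    rw [abs_of_nonpos hu]
    linarith

/-- The Bregman bound at the base point `m` is averaged over `x` and `y`, and the linear terms
cancel. The remainder at `x` is discarded; the one at `y` gives `(1 - θ) ^ p`, so nothing is lost as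
`θ → 0`. -/
theorem abs_rpow_convexComb {p θ : ℝ} (hp : 2 ≤ p) (hθ0 : 0 ≤ θ) (hθ1 : θ ≤ 1) (x y : ℝ) :
    |(1 - θ) * x + θ * y| ^ p + θ * (2 ^ (2 - p) * (1 - θ) ^ p) * |x - y| ^ p
      ≤ (1 - θ) * |x| ^ p + θ * |y| ^ p := by
  set m := (1 - θ) * x + θ * y with hm
  have h1 := abs_rpow_bregman hp m (θ * (x - y))
  have h2 := abs_rpow_bregman hp m ((1 - θ) * (y - x))
  rw [show m + θ * (x - y) = x by rw [hm]; ring] at h1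
  rw [show m + (1 - θ) * (y - x) = y by rw [hm]; ring, abs_mul, abs_sub_comm y x,
    Real.mul_rpow (abs_nonneg _) (abs_nonneg _), abs_of_nonneg (by linarith : 0 ≤ 1 - θ)] at h2
  have h0 : 0 ≤ 2 ^ (2 - p) * |θ * (x - y)| ^ p := by positivity
  have h1' := mul_le_mul_of_nonneg_left h1 (by linarith : 0 ≤ 1 - θ)
  have h2' := mul_le_mul_of_nonneg_left h2 hθ0
  have h0' := mul_nonneg (by linarith : 0 ≤ 1 - θ) h0
  linarith

end RealInequalities

/-! ### Uniform convexity of `L^p` -/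

section LpInequalities

variable {α : Type*} [MeasurableSpace α] {μ : Measure α}

theorem integrable_abs_rpow_coeFn {p : ℝ} (hp : 1 < p) (f : Lp ℝ (ENNReal.ofReal p) μ) :
    Integrable (fun a => |f a| ^ p) μ := by
  have := (Lp.memLp f).integrable_norm_rpow (by simpa using by linarith) ENNReal.ofReal_ne_top
  simpa [ENNReal.toReal_ofReal (show 0 ≤ p by linarith)] using this

theorem norm_rpow_eq_integral {p : ℝ} (hp : 1 < p) (f : Lp ℝ (ENNReal.ofReal p) μ) :
    ‖f‖ ^ p = ∫ a, |f a| ^ p ∂μ := by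
  have h0 : 0 ≤ ∫ a, |f a| ^ p ∂μ := integral_nonneg fun a => by positivity
  rw [Lp.norm_def, (Lp.memLp f).eLpNorm_eq_integral_rpow_norm (by simpa using by linarith)
    ENNReal.ofReal_ne_top, ENNReal.toReal_ofReal (show 0 ≤ p by linarith)]
  simp only [Real.norm_eq_abs]
  rw [ENNReal.toReal_ofReal (Real.rpow_nonneg h0 _), ← Real.rpow_mul h0,
    inv_mul_cancel₀ (by linarith), Real.rpow_one]

/-- Hölder on a two-point space with weights `1` and `p - 1`. Integrated with `M = ‖m‖` and `D =
‖d‖`, it yields the reverse Minkowski inequality in `L^{p/2}`, where `p / 2 ≤ 1`. -/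
theorem sum_rpow_le_of_weights {p M D : ℝ} (hp1 : 1 < p) (hp2 : p ≤ 2)
    (hR : 0 < M ^ 2 + (p - 1) * D ^ 2) (m d : ℝ) :
    (M ^ 2) ^ (1 - p / 2) * |m| ^ p + (p - 1) * ((D ^ 2) ^ (1 - p / 2) * |d| ^ p) ≤
      (M ^ 2 + (p - 1) * D ^ 2) ^ (1 - p / 2) * (m ^ 2 + (p - 1) * d ^ 2) ^ (p / 2) := by
  have hsq : ∀ x : ℝ, |x| ^ p = (x ^ 2) ^ (p / 2) := fun x => by
    rw [← sq_abs, ← Real.rpow_natCast |x| 2, ← Real.rpow_mul (abs_nonneg x)]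
    congr 1; push_cast; ring
  rw [hsq, hsq]
  set R := M ^ 2 + (p - 1) * D ^ 2
  set ρ := m ^ 2 + (p - 1) * d ^ 2 with hρd
  have hρ : 0 ≤ ρ := add_nonneg (sq_nonneg m) (mul_nonneg (by linarith) (sq_nonneg d))
  rcases hρ.eq_or_lt with hρ0 | hρ0
  · have hm : m ^ 2 = 0 := by nlinarith [sq_nonneg m, sq_nonneg d]
    have hd : d ^ 2 = 0 := by nlinarith [sq_nonneg m, sq_nonneg d]
    rw [hm, hd, ← hρ0, Real.zero_rpow (by linarith)]
    simp
  have key : ∀ A a : ℝ, 0 ≤ A → 0 ≤ a → A ^ (1 - p / 2) * a ^ (p / 2) ≤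
      R ^ (1 - p / 2) * ρ ^ (p / 2) * ((1 - p / 2) * (A / R) + p / 2 * (a / ρ)) := by
    intro A a hA ha
    have h := Real.geom_mean_le_arith_mean2_weighted (by linarith : 0 ≤ 1 - p / 2)
      (by linarith : 0 ≤ p / 2) (div_nonneg hA hR.le) (div_nonneg ha hρ) (by ring)
    rw [Real.div_rpow hA hR.le, Real.div_rpow ha hρ] at h
    have h1 : 0 < R ^ (1 - p / 2) := Real.rpow_pos_of_pos hR _
    have h2 : 0 < ρ ^ (p / 2) := Real.rpow_pos_of_pos hρ0 _
    have h3 := mul_le_mul_of_nonneg_left h (mul_pos h1 h2).le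
    refine le_trans (le_of_eq ?_) h3
    field_simp
  have h1 := key (M ^ 2) (m ^ 2) (sq_nonneg _) (sq_nonneg _)
  have h2 := mul_le_mul_of_nonneg_left (key (D ^ 2) (d ^ 2) (sq_nonneg _) (sq_nonneg _))
    (by linarith : 0 ≤ p - 1)
  have h3 : ((1 - p / 2) * (M ^ 2 / R) + p / 2 * (m ^ 2 / ρ)) +
      (p - 1) * ((1 - p / 2) * (D ^ 2 / R) + p / 2 * (d ^ 2 / ρ)) = 1 := by
    have e1 : M ^ 2 / R + (p - 1) * (D ^ 2 / R) = 1 := by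
      rw [← mul_div_assoc, ← add_div]; exact div_self hR.ne'
    have e2 : m ^ 2 / ρ + (p - 1) * (d ^ 2 / ρ) = 1 := by
      rw [← mul_div_assoc, ← add_div]; exact div_self hρ0.ne'
    linear_combination (1 - p / 2) * e1 + p / 2 * e2
  calc _ ≤ _ := add_le_add h1 h2
    _ = R ^ (1 - p / 2) * ρ ^ (p / 2) * (((1 - p / 2) * (M ^ 2 / R) + p / 2 * (m ^ 2 / ρ)) +
      (p - 1) * ((1 - p / 2) * (D ^ 2 / R) + p / 2 * (d ^ 2 / ρ))) := by ring
    _ = _ := by rw [h3, mul_one]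

/-- 2-uniform convexity of `L^p` for `1 < p ≤ 2` (Ball, Carlen and Lieb). -/
theorem norm_sq_add_mul_norm_sq_le {p : ℝ} [Fact (1 ≤ ENNReal.ofReal p)] (hp1 : 1 < p)
    (hp2 : p ≤ 2)
    (m d : Lp ℝ (ENNReal.ofReal p) μ) :
    ‖m‖ ^ 2 + (p - 1) * ‖d‖ ^ 2 ≤ (‖m + d‖ ^ 2 + ‖m - d‖ ^ 2) / 2 := by
  have hR0 : 0 ≤ ‖m‖ ^ 2 + (p - 1) * ‖d‖ ^ 2 :=
    add_nonneg (sq_nonneg _) (mul_nonneg (by linarith) (sq_nonneg _))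
  rcases hR0.eq_or_lt with hR | hR
  · rw [← hR]; positivity
  have hsq : ∀ x : ℝ, 0 ≤ x → x ^ p = (x ^ 2) ^ (p / 2) := fun x hx => by
    rw [← Real.rpow_natCast x 2, ← Real.rpow_mul hx]; congr 1; push_cast; ring
  have hsq2 : ∀ x : ℝ, 0 ≤ x → (x ^ 2) ^ (1 - p / 2) * x ^ p = x ^ 2 := fun x hx => by
    rcases hx.eq_or_lt with rfl | hx
    · rw [Real.zero_rpow (show p ≠ 0 by linarith)]; simp
    · rw [hsq x hx.le, ← Real.rpow_add (by positivity)]; simp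
  set R := ‖m‖ ^ 2 + (p - 1) * ‖d‖ ^ 2 with hRdef
  have hRp : 0 < R ^ (1 - p / 2) := Real.rpow_pos_of_pos hR _
  have hpt : ∀ᵐ a ∂μ, (‖m‖ ^ 2) ^ (1 - p / 2) * |m a| ^ p
      + (p - 1) * ((‖d‖ ^ 2) ^ (1 - p / 2) * |d a| ^ p) ≤
      R ^ (1 - p / 2) * ((|(m + d) a| ^ p + |(m - d) a| ^ p) / 2) := by
    filter_upwards [Lp.coeFn_add m d, Lp.coeFn_sub m d] with a h1 h2
    rw [h1, h2]
    exact (sum_rpow_le_of_weights hp1 hp2 hR (m a) (d a)).trans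
      (mul_le_mul_of_nonneg_left (sq_add_mul_sq_rpow_le hp1 hp2 _ _) hRp.le)
  have im := integrable_abs_rpow_coeFn hp1 m
  have id := integrable_abs_rpow_coeFn hp1 d
  have ia := integrable_abs_rpow_coeFn hp1 (m + d)
  have is := integrable_abs_rpow_coeFn hp1 (m - d)
  have iL := (im.const_mul ((‖m‖ ^ 2) ^ (1 - p / 2))).add
    ((id.const_mul ((‖d‖ ^ 2) ^ (1 - p / 2))).const_mul (p - 1))
  have iR := ((ia.add is).div_const 2).const_mul (R ^ (1 - p / 2))
  have hint := integral_mono_ae iL iR hpt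
  have eL : ∫ a, (‖m‖ ^ 2) ^ (1 - p / 2) * |m a| ^ p
      + (p - 1) * ((‖d‖ ^ 2) ^ (1 - p / 2) * |d a| ^ p) ∂μ = R := by
    rw [integral_add (im.const_mul _) ((id.const_mul _).const_mul _), integral_const_mul,
      integral_const_mul, integral_const_mul, ← norm_rpow_eq_integral hp1,
      ← norm_rpow_eq_integral hp1, hsq2 _ (norm_nonneg _), hsq2 _ (norm_nonneg _)]
  have eR : ∫ a, R ^ (1 - p / 2) * ((|(m + d) a| ^ p + |(m - d) a| ^ p) / 2) ∂μ =
      R ^ (1 - p / 2) * (((‖m + d‖ ^ 2) ^ (p / 2) + (‖m - d‖ ^ 2) ^ (p / 2)) / 2) := by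
    rw [integral_const_mul, integral_div, integral_add ia is, ← norm_rpow_eq_integral hp1,
      ← norm_rpow_eq_integral hp1, hsq ‖m + d‖ (norm_nonneg _), hsq ‖m - d‖ (norm_nonneg _)]
  have hint' := (eL.symm.trans_le hint).trans_eq eR
  -- Concavity of `t ^ (p / 2)` turns the mean of `p`-th powers of norms into a power of the mean of
  -- squares.
  have hconc := (Real.concaveOn_rpow (p := p / 2) (by linarith) (by linarith)).2
    (Set.mem_Ici.2 (sq_nonneg ‖m + d‖)) (Set.mem_Ici.2 (sq_nonneg ‖m - d‖))
    (by norm_num : (0 : ℝ) ≤ 1 / 2) (by norm_num : (0 : ℝ) ≤ 1 / 2) (by norm_num)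
  simp only [smul_eq_mul] at hconc
  have h2 : R ^ (1 - p / 2) * R ^ (p / 2) ≤
      R ^ (1 - p / 2) * ((‖m + d‖ ^ 2 + ‖m - d‖ ^ 2) / 2) ^ (p / 2) := by
    rw [← Real.rpow_add hR, sub_add_cancel, Real.rpow_one]
    refine hint'.trans (mul_le_mul_of_nonneg_left ?_ hRp.le)
    refine le_trans (le_of_eq (by ring)) (hconc.trans (le_of_eq (by congr 1; ring)))
  exact (Real.rpow_le_rpow_iff hR0 (by positivity) (by linarith)).1 (le_of_mul_le_mul_left h2 hRp)

/-- `‖·‖ ^ r` is uniformly convex with constant `c`, at some ratio. -/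
def NormRpowUniformConvex (E : Type*) [NormedAddCommGroup E] [NormedSpace ℝ E] (r c : ℝ) : Prop :=
  ∃ θ : ℝ, 0 < θ ∧ θ < 1 ∧ ∀ x y : E,
    ‖(1 - θ) • x + θ • y‖ ^ r + θ * c * ‖x - y‖ ^ r ≤ (1 - θ) * ‖x‖ ^ r + θ * ‖y‖ ^ r

theorem normRpowUniformConvex_two {p : ℝ} [Fact (1 ≤ ENNReal.ofReal p)] (hp1 : 1 < p)
    (hp2 : p ≤ 2) : NormRpowUniformConvex (Lp ℝ (ENNReal.ofReal p) μ) 2 ((p - 1) / 2) := by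
  refine ⟨1 / 2, by norm_num, by norm_num, fun x y => ?_⟩
  have h := norm_sq_add_mul_norm_sq_le hp1 hp2 ((1 / 2 : ℝ) • x + (1 / 2 : ℝ) • y)
    ((1 / 2 : ℝ) • (x - y))
  rw [show (1 / 2 : ℝ) • x + (1 / 2 : ℝ) • y + (1 / 2 : ℝ) • (x - y) = x by module,
    show (1 / 2 : ℝ) • x + (1 / 2 : ℝ) • y - (1 / 2 : ℝ) • (x - y) = y by module,
    norm_smul (1 / 2 : ℝ) (x - y)] at h
  norm_num at h ⊢
  linarith

/-- The pointwise bound `abs_rpow_convexComb` is integrated; `c` is strictly below the limiting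
constant, so a small `θ > 0` suffices. -/
theorem normRpowUniformConvex_of_two_le {p c : ℝ} [Fact (1 ≤ ENNReal.ofReal p)] (hp : 2 ≤ p)
    (hc : c < 2 ^ (2 - p)) : NormRpowUniformConvex (Lp ℝ (ENNReal.ofReal p) μ) p c := by
  have hp1 : 1 < p := by linarith
  obtain ⟨θ, hθ0, hθ1, hθ⟩ : ∃ θ : ℝ, 0 < θ ∧ θ < 1 ∧ c ≤ 2 ^ (2 - p) * (1 - θ) ^ p := by
    have hcont : Continuous (fun θ : ℝ => (2 : ℝ) ^ (2 - p) * (1 - θ) ^ p) :=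
      (Continuous.rpow_const (by fun_prop) fun _ => Or.inr (by linarith)).const_mul _
    have h1 : ∀ᶠ θ in nhdsWithin (0 : ℝ) (Set.Ioi 0), c < 2 ^ (2 - p) * (1 - θ) ^ p :=
      (hcont.tendsto 0).mono_left nhdsWithin_le_nhds |>.eventually (lt_mem_nhds (by simpa using hc))
    obtain ⟨θ, h, h'⟩ := (h1.and (Ioo_mem_nhdsGT (zero_lt_one' ℝ))).exists
    exact ⟨θ, h'.1, h'.2, h.le⟩
  refine ⟨θ, hθ0, hθ1, fun x y => ?_⟩
  refine le_trans (b := ‖(1 - θ) • x + θ • y‖ ^ p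
    + θ * (2 ^ (2 - p) * (1 - θ) ^ p) * ‖x - y‖ ^ p) (by gcongr) ?_
  rw [norm_rpow_eq_integral hp1, norm_rpow_eq_integral hp1, norm_rpow_eq_integral hp1,
    norm_rpow_eq_integral hp1, ← integral_const_mul, ← integral_const_mul, ← integral_const_mul,
    ← integral_add (integrable_abs_rpow_coeFn hp1 _)
      ((integrable_abs_rpow_coeFn hp1 _).const_mul _),
    ← integral_add ((integrable_abs_rpow_coeFn hp1 _).const_mul _)
      ((integrable_abs_rpow_coeFn hp1 _).const_mul _)]
  refine integral_mono_ae ((integrable_abs_rpow_coeFn hp1 _).add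
      ((integrable_abs_rpow_coeFn hp1 _).const_mul _))
    (((integrable_abs_rpow_coeFn hp1 _).const_mul _).add
      ((integrable_abs_rpow_coeFn hp1 _).const_mul _)) ?_
  filter_upwards [Lp.coeFn_add ((1 - θ) • x) (θ • y), Lp.coeFn_smul (1 - θ) x,
    Lp.coeFn_smul θ y, Lp.coeFn_sub x y] with a h1 h2 h3 h4
  rw [h1, h4, Pi.add_apply, h2, h3]
  exact abs_rpow_convexComb hp hθ0.le hθ1.le (x a) (y a)

end LpInequalities

/-! ### The potential of follow-the-regularized-leader -/

section Potential

variable {E : Type*} [NormedAddCommGroup E] [NormedSpace ℝ E]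

/-- The potential `sup_{g ∈ C} (φ g - ‖g - e‖ ^ r / η)` of regularized follow-the-leader. -/
noncomputable def potential (C : Set E) (e : E) (r η : ℝ) (φ : StrongDual ℝ E) : ℝ :=
  ⨆ g : C, (φ g - ‖(g : E) - e‖ ^ r / η)

variable {C : Set E} {e : E} {r r' η : ℝ}

theorem bddAbove_potential (hr : r.HolderConjugate r') (hη : 0 < η) (φ : StrongDual ℝ E) :
    BddAbove (Set.range fun g : C => φ g - ‖(g : E) - e‖ ^ r / η) := by
  refine ⟨φ e + 1 / r' * (1 / (r * (1 / η))) ^ (r' - 1) * ‖φ‖ ^ r', ?_⟩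
  rintro _ ⟨g, rfl⟩
  have h1 : φ g = φ e + φ (g - e) := by rw [map_sub]; ring
  have h2 : φ (g - e) ≤ ‖φ‖ * ‖(g : E) - e‖ := (le_abs_self _).trans (φ.le_opNorm _)
  have h3 := mul_le_rpow_add_rpow hr (norm_nonneg ((g : E) - e)) (norm_nonneg φ)
    (one_div_pos.2 hη)
  have h4 : ‖(g : E) - e‖ ^ r / η = 1 / η * ‖(g : E) - e‖ ^ r := by ring
  simp only [h4]
  linarith

theorem le_potential (hr : r.HolderConjugate r') (hη : 0 < η) (φ : StrongDual ℝ E) {g : E}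
    (hg : g ∈ C) : φ g - ‖g - e‖ ^ r / η ≤ potential C e r η φ :=
  le_ciSup (bddAbove_potential hr hη φ) (⟨g, hg⟩ : C)

theorem potential_zero_le (hη : 0 < η) (he : e ∈ C) : potential C e r η 0 ≤ 0 := by
  have : Nonempty C := ⟨⟨e, he⟩⟩
  refine ciSup_le fun g => ?_
  have : 0 ≤ ‖(g : E) - e‖ ^ r / η := by positivity
  simpa using this

/-- One step of optimistic follow-the-regularized-leader: the linear functional `ρ` is known to
the player in advance, so that only `ψ` enters the stability term. -/
theorem exists_potential_add_sub_le (hr : r.HolderConjugate r') (hη : 0 < η) (he : e ∈ C)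
    (hC : Convex ℝ C) {c : ℝ} (hc : 0 < c) (huc : NormRpowUniformConvex E r c) {ε : ℝ}
    (hε : 0 < ε) (φ ρ : StrongDual ℝ E) :
    ∃ g ∈ C, ∀ ψ : StrongDual ℝ E, potential C e r η (φ + (ρ - ψ)) ≤
      potential C e r η φ + (ρ g - ψ g) + 1 / r' * (η / (r * c)) ^ (r' - 1) * ‖ψ‖ ^ r' + ε := by
  have hne : Nonempty C := ⟨⟨e, he⟩⟩
  obtain ⟨θ, hθ0, hθ1, huc⟩ := huc
  set V : E → ℝ := fun g => (φ + ρ) g - ‖g - e‖ ^ r / η with hV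
  set Ψ := potential C e r η (φ + ρ) with hΨ
  -- The supremum need not be attained, so `g` is a near-maximizer. Its tolerance carries a factor
  -- `θ` because the convexity estimate is divided by `θ` below.
  have hε' : 0 < θ * (ε / 2) := by positivity
  obtain ⟨⟨g, hg⟩, hgV⟩ := exists_lt_of_lt_ciSup (show Ψ - θ * (ε / 2) < Ψ by linarith)
  have hgV : Ψ - θ * (ε / 2) < V g := hgV
  have hΨg : Ψ ≤ potential C e r η φ + ρ g + ε / 2 := by
    have h1 := le_potential (e := e) hr hη φ hg
    have h2 : V g = φ g - ‖g - e‖ ^ r / η + ρ g := by simp [hV]; ring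
    nlinarith
  refine ⟨g, hg, fun ψ => ciSup_le ?_⟩
  rintro ⟨x, hx⟩
  have hmem : (1 - θ) • g + θ • x ∈ C := hC hg hx (by linarith) hθ0.le (by ring)
  have h1 : V ((1 - θ) • g + θ • x) ≤ Ψ := le_potential hr hη (φ + ρ) hmem
  have h2 := huc (g - e) (x - e)
  rw [show (1 - θ) • (g - e) + θ • (x - e) = (1 - θ) • g + θ • x - e by module,
    show g - e - (x - e) = g - x by abel] at h2
  have h3 : (1 - θ) * V g + θ * V x + θ * (c / η * ‖g - x‖ ^ r) ≤
      V ((1 - θ) • g + θ • x) := by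
    have h2' := div_le_div_of_nonneg_right h2 hη.le
    have e1 : (φ + ρ) ((1 - θ) • g + θ • x) = (1 - θ) * (φ + ρ) g + θ * (φ + ρ) x := by
      rw [map_add, map_smul, map_smul, smul_eq_mul, smul_eq_mul]
    simp only [hV, e1]
    calc _ = (1 - θ) * (φ + ρ) g + θ * (φ + ρ) x
        - ((1 - θ) * ‖g - e‖ ^ r + θ * ‖x - e‖ ^ r) / η + θ * c * ‖g - x‖ ^ r / η := by ring
      _ ≤ (1 - θ) * (φ + ρ) g + θ * (φ + ρ) x
        - (‖(1 - θ) • g + θ • x - e‖ ^ r + θ * c * ‖g - x‖ ^ r) / η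
          + θ * c * ‖g - x‖ ^ r / η := by linarith
      _ = _ := by ring
  -- Quadratic-growth analogue: `V` falls off from the near-maximizer `g` at rate `c / η * ‖g - x‖ ^
  -- r`, which absorbs `ψ (g - x)` through Young's inequality.
  have h4 : V x + c / η * ‖g - x‖ ^ r ≤ Ψ + ε / 2 := by
    have : θ * (V x + c / η * ‖g - x‖ ^ r) ≤ θ * (Ψ + ε / 2) := by nlinarith
    exact le_of_mul_le_mul_left this hθ0
  have h5 : ψ (g - x) ≤ ‖ψ‖ * ‖g - x‖ := (le_abs_self _).trans (ψ.le_opNorm _)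
  have h6 := mul_le_rpow_add_rpow hr (norm_nonneg (g - x)) (norm_nonneg ψ) (div_pos hc hη)
  rw [show 1 / (r * (c / η)) = η / (r * c) by field_simp] at h6
  rw [map_sub] at h5
  have h7 : (φ + (ρ - ψ)) x - ‖x - e‖ ^ r / η = V x - ψ x := by simp [hV]; ring
  simp only [h7]
  linarith

/-- By continuity in `g`, the supremum may be taken over a dense sequence of `C`. -/
theorem measurable_potential [SecondCountableTopology E] (hr : r.HolderConjugate r') (hη : 0 < η)
    (he : e ∈ C) {Ω : Type*} [MeasurableSpace Ω] {Φ : Ω → StrongDual ℝ E}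
    (hΦ : ∀ g, Measurable fun s => Φ s g) :
    Measurable fun s => potential C e r η (Φ s) := by
  have hne : Nonempty C := ⟨⟨e, he⟩⟩
  have hcongr : ∀ s, potential C e r η (Φ s) = ⨆ k : ℕ,
      (Φ s (TopologicalSpace.denseSeq C k) -
        ‖(TopologicalSpace.denseSeq C k : E) - e‖ ^ r / η) := by
    intro s
    have hbdd := bddAbove_potential (C := C) (e := e) hr hη (Φ s)
    have hbdd' : BddAbove (Set.range fun k : ℕ => (Φ s (TopologicalSpace.denseSeq C k) -
        ‖(TopologicalSpace.denseSeq C k : E) - e‖ ^ r / η)) :=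
      hbdd.mono (by rintro _ ⟨k, rfl⟩; exact ⟨TopologicalSpace.denseSeq C k, rfl⟩)
    refine le_antisymm (ciSup_le fun g => ?_)
      (ciSup_le fun k => le_ciSup hbdd (TopologicalSpace.denseSeq C k))
    have hcont : Continuous fun g : C => Φ s g - ‖(g : E) - e‖ ^ r / η :=
      ((Φ s).continuous.comp continuous_subtype_val).sub
        ((Continuous.rpow_const (by fun_prop) fun _ => Or.inr hr.nonneg).div_const _)
    have hcl := isClosed_le hcont (continuous_const (y := ⨆ k : ℕ,
      (Φ s (TopologicalSpace.denseSeq C k) -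
        ‖(TopologicalSpace.denseSeq C k : E) - e‖ ^ r / η)))
    have hd := (TopologicalSpace.denseRange_denseSeq C).closure_eq
    have hsub := closure_minimal (s := Set.range (TopologicalSpace.denseSeq C))
      (by rintro _ ⟨k, rfl⟩; exact le_ciSup hbdd' k) hcl
    rw [hd] at hsub
    exact hsub (Set.mem_univ g)
  simp only [hcongr]
  exact Measurable.iSup fun k => (hΦ _).sub_const _

end Potential

/-! ### Iterating the one-step estimate over a product measure -/

section Supermartingale

variable {Z : Type*} [MeasurableSpace Z] {μ : Measure Z} [SigmaFinite μ]

/-- Peel off coordinate `0`. The induction hypothesis, used at the shifted start `φ + d z`, bounds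
the integral over the others, and `hstep` bounds the integral over `z`. -/
theorem lintegral_pi_add_sum_mul_prod_le {G : Type*} [AddCommMonoid G] {Φ : G → ℝ≥0∞} {d : Z → G}
    {w : Z → ℝ≥0∞} {M : ℝ≥0∞} (hw : Measurable w)
    (hΦ : ∀ (n : ℕ) (φ : G), Measurable fun S : Fin n → Z => Φ (φ + ∑ t, d (S t)))
    (hstep : ∀ φ, ∫⁻ z, Φ (φ + d z) * w z ∂μ ≤ Φ φ * M) (n : ℕ) (φ : G) :
    ∫⁻ S : Fin n → Z, Φ (φ + ∑ t, d (S t)) * ∏ t, w (S t) ∂Measure.pi (fun _ => μ) ≤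
      Φ φ * M ^ n := by
  induction n generalizing φ with
  | zero => simp
  | succ n ih =>
    have hmp := (measurePreserving_piFinSuccAbove (fun _ : Fin (n + 1) => μ) 0).symm
    have hmeas : Measurable fun S : Fin (n + 1) → Z => Φ (φ + ∑ t, d (S t)) * ∏ t, w (S t) :=
      (hΦ _ φ).mul (Finset.measurable_prod _ fun t _ => hw.comp (measurable_pi_apply t))
    rw [← hmp.lintegral_comp hmeas,
      lintegral_prod (fun a : Z × (Fin n → Z) =>
        Φ (φ + ∑ t, d ((MeasurableEquiv.piFinSuccAbove (fun _ => Z) 0).symm a t)) *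
        ∏ t, w ((MeasurableEquiv.piFinSuccAbove (fun _ => Z) 0).symm a t))
        (hmeas.comp (MeasurableEquiv.measurable _)).aemeasurable]
    calc _ = ∫⁻ z, w z * ∫⁻ S : Fin n → Z, Φ ((φ + d z) + ∑ t, d (S t)) * ∏ t, w (S t)
          ∂Measure.pi (fun _ => μ) ∂μ := by
          refine lintegral_congr fun z => ?_
          have hm : Measurable fun S : Fin n → Z =>
              Φ ((φ + d z) + ∑ t, d (S t)) * ∏ t, w (S t) :=
            (hΦ n _).mul (Finset.measurable_prod _ fun t _ => hw.comp (measurable_pi_apply t))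
          rw [← lintegral_const_mul _ hm]
          refine lintegral_congr fun S => ?_
          simp [MeasurableEquiv.piFinSuccAbove, Fin.sum_univ_succ, Fin.prod_univ_succ, add_assoc]
          ring
      _ ≤ ∫⁻ z, Φ (φ + d z) * w z * M ^ n ∂μ := by
          refine lintegral_mono fun z => ?_
          calc _ ≤ w z * (Φ (φ + d z) * M ^ n) := by gcongr; exact ih _
            _ = _ := by ring
      _ ≤ Φ φ * M ^ (n + 1) := by
          have h1 : Measurable fun z => Φ (φ + d z) := by
            have := (hΦ 1 φ).comp (measurable_pi_lambda (fun z (_ : Fin 1) => z)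
              fun _ => measurable_id)
            simpa [Function.comp_def] using this
          have h2 : Measurable fun z => Φ (φ + d z) * w z := h1.mul hw
          rw [lintegral_mul_const _ h2, pow_succ', ← mul_assoc]
          gcongr
          exact hstep φ

end Supermartingale

/-! ### High-probability bound on the potential -/

section Deviation

variable {E : Type*} [NormedAddCommGroup E] [NormedSpace ℝ E] [SecondCountableTopology E]
  {Z : Type*} [MeasurableSpace Z] {μ : Measure Z} [IsProbabilityMeasure μ]
  {C : Set E} {e : E} {r r' η K K₀ ε lam σ δ : ℝ} {ρ : StrongDual ℝ E} {ψ : Z → StrongDual ℝ E}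
  {N : Z → ℝ≥0∞}

theorem measurable_potential_add_sum (hr : r.HolderConjugate r') (hη : 0 < η) (he : e ∈ C)
    (hψ : ∀ g, Measurable fun z => ψ z g) (n : ℕ) (φ : StrongDual ℝ E) :
    Measurable fun S : Fin n → Z => potential C e r η (φ + ∑ t, (ρ - ψ (S t))) := by
  refine measurable_potential hr hη he fun g => ?_
  simp only [add_apply, sum_apply, sub_apply]
  exact measurable_const.add (Finset.measurable_sum _ fun t _ =>
    measurable_const.sub ((hψ g).comp (measurable_pi_apply t)))

theorem measure_potential_gt_le (hr : r.HolderConjugate r') (hη : 0 < η) (he : e ∈ C)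
    (hψ : ∀ g, Measurable fun z => ψ z g) (hN : Measurable N)
    (hψN : ∀ z, N z ≠ ∞ → ‖ψ z‖ ≤ (N z).toReal) (hK : 0 ≤ K) (hlam : 0 < lam) (hδ : 0 < δ)
    (hstep : ∀ φ, ∃ g ∈ C, ∀ ψ' : StrongDual ℝ E, potential C e r η (φ + (ρ - ψ')) ≤
      potential C e r η φ + (ρ g - ψ' g) + K * ‖ψ'‖ ^ r' + ε)
    (hmgf : ∀ g ∈ C, ∫⁻ z in {z | N z ≠ ∞}, ENNReal.ofReal (Real.exp (lam * (ρ g - ψ z g))) ∂μ ≤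
      ENNReal.ofReal (Real.exp σ)) (n : ℕ) :
    Measure.pi (fun _ : Fin n => μ) {S | (∀ t, N (S t) ≠ ∞) ∧
      n * σ + n * (lam * ε) + Real.log (1 / δ) < lam * (potential C e r η (∑ t, (ρ - ψ (S t)))
        - K * ∑ t, (N (S t)).toReal ^ r')} ≤ ENNReal.ofReal δ := by
  classical
  set Φ : StrongDual ℝ E → ℝ≥0∞ := fun φ =>
    ENNReal.ofReal (Real.exp (lam * potential C e r η φ)) with hΦ
  -- The weight discounts the stability penalty and kills samples whose loss section has infinite
  -- norm, where no bound on `ψ` is assumed.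
  set w : Z → ℝ≥0∞ := {z | N z ≠ ∞}.indicator fun z =>
    ENNReal.ofReal (Real.exp (-(lam * (K * (N z).toReal ^ r')))) with hw
  have hset : MeasurableSet {z | N z ≠ ∞} := (hN (measurableSet_singleton ∞)).compl
  have hwm : Measurable w := Measurable.indicator (by fun_prop) hset
  have hr'0 : 0 ≤ r' := hr.symm.nonneg
  have hs : ∀ φ, ∫⁻ z, Φ (φ + (ρ - ψ z)) * w z ∂μ ≤
      Φ φ * ENNReal.ofReal (Real.exp (σ + lam * ε)) := by
    intro φ
    obtain ⟨g, hg, hgs⟩ := hstep φ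
    have h1 : ∀ z, Φ (φ + (ρ - ψ z)) * w z ≤ {z | N z ≠ ∞}.indicator (fun z =>
        (Φ φ * ENNReal.ofReal (Real.exp (lam * ε))) *
          ENNReal.ofReal (Real.exp (lam * (ρ g - ψ z g)))) z := by
      intro z
      by_cases hz : N z ≠ ∞
      · simp only [hw, hΦ, Set.indicator_of_mem (show z ∈ {z | N z ≠ ∞} from hz)]
        rw [← ENNReal.ofReal_mul (Real.exp_nonneg _), ← ENNReal.ofReal_mul (Real.exp_nonneg _),
          ← ENNReal.ofReal_mul (by positivity), ← Real.exp_add, ← Real.exp_add, ← Real.exp_add]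
        refine ENNReal.ofReal_le_ofReal (Real.exp_le_exp.2 ?_)
        have h2 := hgs (ψ z)
        have h3 : K * ‖ψ z‖ ^ r' ≤ K * (N z).toReal ^ r' := by
          gcongr
          exact hψN z hz
        have h4 := mul_le_mul_of_nonneg_left (h2.trans (add_le_add_left (add_le_add_right h3 _) _))
          hlam.le
        linarith
      · simp only [hw, Set.indicator_of_notMem (show z ∉ {z | N z ≠ ∞} from hz)]
        simp
    calc _ ≤ _ := lintegral_mono h1
      _ = (Φ φ * ENNReal.ofReal (Real.exp (lam * ε))) *
          ∫⁻ z in {z | N z ≠ ∞}, ENNReal.ofReal (Real.exp (lam * (ρ g - ψ z g))) ∂μ := by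
          rw [lintegral_indicator hset, lintegral_const_mul]
          have := hψ g
          fun_prop
      _ ≤ (Φ φ * ENNReal.ofReal (Real.exp (lam * ε))) * ENNReal.ofReal (Real.exp σ) := by
          gcongr; exact hmgf g hg
      _ = _ := by
          rw [mul_assoc, ← ENNReal.ofReal_mul (Real.exp_nonneg _), ← Real.exp_add, add_comm σ]
  have hΦm : ∀ (n : ℕ) φ, Measurable fun S : Fin n → Z => Φ (φ + ∑ t, (ρ - ψ (S t))) :=
    fun n φ => by
      have := measurable_potential_add_sum (ρ := ρ) hr hη he hψ n φ
      exact (Real.measurable_exp.comp (this.const_mul lam)).ennreal_ofReal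
  have hmain := lintegral_pi_add_sum_mul_prod_le hwm hΦm hs n 0
  have hM := meas_ge_le_lintegral_div (μ := Measure.pi (fun _ : Fin n => μ))
    (f := fun S => Φ (0 + ∑ t, (ρ - ψ (S t))) * ∏ t, w (S t))
    (((hΦm n 0).mul (Finset.measurable_prod _ fun t _ =>
      hwm.comp (measurable_pi_apply t))).aemeasurable)
    -- Markov threshold: the expectation is at most `exp (n * (σ + lam * ε))`, as the potential at
    -- `0` is nonpositive, so the extra `log (1 / δ)` leaves probability `δ`.
    (ε := ENNReal.ofReal (Real.exp (n * (σ + lam * ε) + Real.log (1 / δ))))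
    (by simpa using Real.exp_pos _) ENNReal.ofReal_ne_top
  refine (measure_mono ?_).trans (hM.trans ?_)
  · rintro S ⟨hS, hlt⟩
    have hprod : ∏ t, w (S t) = ENNReal.ofReal
        (Real.exp (-(lam * (K * ∑ t, (N (S t)).toReal ^ r')))) := by
      rw [Finset.mul_sum, Finset.mul_sum, ← Finset.sum_neg_distrib, Real.exp_sum,
        ENNReal.ofReal_prod_of_nonneg fun _ _ => Real.exp_nonneg _]
      exact Finset.prod_congr rfl fun t _ =>
        Set.indicator_of_mem (show S t ∈ {z | N z ≠ ∞} from hS t) _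
    simp only [Set.mem_ofPred_eq, hprod, hΦ, zero_add]
    rw [← ENNReal.ofReal_mul (Real.exp_nonneg _), ← Real.exp_add]
    refine ENNReal.ofReal_le_ofReal (Real.exp_le_exp.2 ?_)
    linarith
  · refine ENNReal.div_le_of_le_mul (hmain.trans ?_)
    have h0 : Φ 0 ≤ 1 := by
      simp only [hΦ]
      rw [← ENNReal.ofReal_one]
      refine ENNReal.ofReal_le_ofReal (Real.exp_le_one_iff.2 ?_)
      exact mul_nonpos_of_nonneg_of_nonpos hlam.le (potential_zero_le hη he)
    calc _ ≤ 1 * ENNReal.ofReal (Real.exp (σ + lam * ε)) ^ n := by gcongr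
      _ = ENNReal.ofReal δ * ENNReal.ofReal (Real.exp (n * (σ + lam * ε) + Real.log (1 / δ))) := by
        rw [one_mul, ← ENNReal.ofReal_pow (Real.exp_nonneg _), ← Real.exp_nat_mul,
          ← ENNReal.ofReal_mul hδ.le, Real.exp_add _ (Real.log _), Real.exp_log (by positivity)]
        congr 1
        field_simp
      _ ≤ _ := le_rfl

/-- The deviation bound, with the constant `K₀` attained as a limit. -/
theorem measure_potential_gt_le_of_forall_gt (hr : r.HolderConjugate r') (hη : 0 < η) (he : e ∈ C)
    (hψ : ∀ g, Measurable fun z => ψ z g) (hN : Measurable N)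
    (hψN : ∀ z, N z ≠ ∞ → ‖ψ z‖ ≤ (N z).toReal) (hK : 0 ≤ K₀) (hlam : 0 < lam) (hδ : 0 < δ)
    (hstep : ∀ K > K₀, ∀ ε > 0, ∀ φ, ∃ g ∈ C, ∀ ψ' : StrongDual ℝ E,
      potential C e r η (φ + (ρ - ψ')) ≤
      potential C e r η φ + (ρ g - ψ' g) + K * ‖ψ'‖ ^ r' + ε)
    (hmgf : ∀ g ∈ C, ∫⁻ z in {z | N z ≠ ∞}, ENNReal.ofReal (Real.exp (lam * (ρ g - ψ z g))) ∂μ ≤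
      ENNReal.ofReal (Real.exp σ)) (n : ℕ) :
    Measure.pi (fun _ : Fin n => μ) {S | (∀ t, N (S t) ≠ ∞) ∧
      n * σ + Real.log (1 / δ) < lam * (potential C e r η (∑ t, (ρ - ψ (S t)))
        - K₀ * ∑ t, (N (S t)).toReal ^ r')} ≤ ENNReal.ofReal δ := by
  -- `x k` serves both as the excess of `K` over `K₀` and as `ε`. The events increase with `k`, so
  -- continuity from below preserves the bound `δ` for their union.
  set x : ℕ → ℝ := fun k => 1 / ((k : ℝ) + 1) with hx
  have hx0 : ∀ k, 0 < x k := fun k => Nat.one_div_pos_of_nat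
  set bad : ℕ → Set (Fin n → Z) := fun k => {S | (∀ t, N (S t) ≠ ∞) ∧
      n * σ + n * (lam * x k) + Real.log (1 / δ) <
        lam * (potential C e r η (∑ t, (ρ - ψ (S t)))
        - (K₀ + x k) * ∑ t, (N (S t)).toReal ^ r')} with hbad
  have hb : ∀ k, Measure.pi (fun _ : Fin n => μ) (bad k) ≤ ENNReal.ofReal δ := fun k =>
    measure_potential_gt_le hr hη he hψ hN hψN (by linarith [hx0 k]) hlam hδ
      (hstep _ (by linarith [hx0 k]) _ (hx0 k)) hmgf n
  have hA0 : ∀ S : Fin n → Z, 0 ≤ ∑ t, (N (S t)).toReal ^ r' := fun S =>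
    Finset.sum_nonneg fun t _ => by positivity
  have hmono : Monotone bad := by
    rintro k l hkl S ⟨hS, hlt⟩
    have hxl : x l ≤ x k := Nat.one_div_le_one_div hkl
    refine ⟨hS, ?_⟩
    have h1 : n * (lam * x l) ≤ n * (lam * x k) := by gcongr
    have h2 : lam * (x l * ∑ t, (N (S t)).toReal ^ r') ≤
        lam * (x k * ∑ t, (N (S t)).toReal ^ r') := by
      have := hA0 S
      gcongr
    linarith
  refine (measure_mono (t := ⋃ k, bad k) ?_).trans ?_
  · rintro S ⟨hS, hlt⟩
    set A := ∑ t, (N (S t)).toReal ^ r' with hA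
    set gap := lam * (potential C e r η (∑ t, (ρ - ψ (S t))) - K₀ * A)
      - (n * σ + Real.log (1 / δ)) with hgap
    have hgap0 : 0 < gap := by linarith
    have hD : 0 < n * lam + lam * A + 1 := by
      have := hA0 S
      positivity
    obtain ⟨k, hk⟩ := exists_nat_one_div_lt (div_pos hgap0 hD)
    refine Set.mem_iUnion.2 ⟨k, hS, ?_⟩
    have hk' : x k * (n * lam + lam * A + 1) < gap := by
      rwa [lt_div_iff₀ hD] at hk
    have := hx0 k
    linarith
  · rw [hmono.measure_iUnion]
    exact iSup_le hb

end Deviation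

/-! ### Duality between `L^b` and `L^a`, and the convex set of densities -/

section Pairing

variable {W : Type*} [MeasurableSpace W] {P₁ : Measure W} {a b : ℝ≥0∞} [Fact (1 ≤ a)]
  [Fact (1 ≤ b)] [ENNReal.HolderConjugate b a]

open Classical in
variable (P₁ a b) in
/-- The functional `g ↦ ∫ f g dP₁` on `L^a`, for `f` in the conjugate space `L^b`; zero for other
functions. -/
noncomputable def pairing (f : W → ℝ) : StrongDual ℝ (Lp ℝ a P₁) :=
  if hf : MemLp f b P₁ then
    ContinuousLinearMap.lpPairing P₁ b a (ContinuousLinearMap.mul ℝ ℝ) (hf.toLp f)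
  else 0

theorem pairing_apply {f : W → ℝ} (hf : MemLp f b P₁) (g : Lp ℝ a P₁) :
    pairing P₁ a b f g = ∫ w, f w * g w ∂P₁ := by
  rw [pairing, dif_pos hf, ContinuousLinearMap.lpPairing_eq_integral]
  refine integral_congr_ae ?_
  filter_upwards [hf.coeFn_toLp] with w hw
  simp [hw]

theorem pairing_of_not_memLp {f : W → ℝ} (hf : ¬ MemLp f b P₁) : pairing P₁ a b f = 0 :=
  dif_neg hf

theorem integrable_mul_of_memLp {f : W → ℝ} (hf : MemLp f b P₁) (g : Lp ℝ a P₁) :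
    Integrable (fun w => f w * g w) P₁ :=
  hf.integrable_mul (Lp.memLp g)

theorem norm_pairing_le {f : W → ℝ} (hf : MemLp f b P₁) :
    ‖pairing P₁ a b f‖ ≤ (eLpNorm f b P₁).toReal := by
  rw [pairing, dif_pos hf, ← Lp.norm_toLp f hf]
  refine ContinuousLinearMap.opNorm_le_bound _ (norm_nonneg _) fun g => ?_
  have h1 := ContinuousLinearMap.norm_holder_apply_apply_le (r := 1)
    (ContinuousLinearMap.mul ℝ ℝ) (hf.toLp f) g
  refine le_trans ?_ (h1.trans ?_)
  · have h2 : ContinuousLinearMap.lpPairing P₁ b a (ContinuousLinearMap.mul ℝ ℝ) (hf.toLp f) g =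
        L1.integral ((ContinuousLinearMap.mul ℝ ℝ).holder 1 (hf.toLp f) g) := by
      simp [ContinuousLinearMap.lpPairing, ← L1.integral_eq']
    rw [h2]
    exact L1.norm_integral_le _
  · have h2 := ContinuousLinearMap.opNorm_mul_le ℝ ℝ
    calc _ ≤ 1 * ‖hf.toLp f‖ * ‖g‖ := by gcongr
      _ = _ := by rw [one_mul]

variable (P₁ a) in
/-- The probability densities in `L^a`. -/
def densities : Set (Lp ℝ a P₁) := {g | 0 ≤ᵐ[P₁] g ∧ ∫ w, g w ∂P₁ = 1}

theorem convex_densities [IsFiniteMeasure P₁] : Convex ℝ (densities P₁ a) := by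
  rintro g ⟨hg0, hg1⟩ h ⟨hh0, hh1⟩ s t hs ht hst
  have hae : ⇑(s • g + t • h) =ᵐ[P₁] fun w => s * g w + t * h w := by
    filter_upwards [Lp.coeFn_add (s • g) (t • h), Lp.coeFn_smul s g, Lp.coeFn_smul t h]
      with w h1 h2 h3
    rw [h1, Pi.add_apply, h2, h3]
    rfl
  refine ⟨?_, ?_⟩
  · filter_upwards [hae, hg0, hh0] with w h1 h2 h3
    rw [h1]
    exact add_nonneg (mul_nonneg hs h2) (mul_nonneg ht h3)
  · have ig := (Lp.memLp g).integrable Fact.out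
    have ih := (Lp.memLp h).integrable Fact.out
    rw [integral_congr_ae hae, integral_add (ig.const_mul _) (ih.const_mul _),
      integral_const_mul, integral_const_mul, hg1, hh1]
    linarith

theorem toLp_one_mem_densities [IsProbabilityMeasure P₁] :
    (memLp_const (1 : ℝ)).toLp (fun _ => (1 : ℝ)) ∈ densities P₁ a := by
  have h := (memLp_const (μ := P₁) (p := a) (1 : ℝ)).coeFn_toLp
  refine ⟨?_, ?_⟩
  · filter_upwards [h] with w hw
    rw [hw]
    exact zero_le_one
  · rw [integral_congr_ae h]
    simp

end Pairing

/-! ### One-sided exponential moments of nonnegative variables -/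

section MomentGenerating

/-- Follows from `exp y ≥ 1 + y + y ^ 2 / 2` and `(1 + y + y ^ 2 / 2) * (1 - y + y ^ 2 / 2) = 1 + y
^ 4 / 4`. -/
theorem exp_neg_le_quadratic {y : ℝ} (hy : 0 ≤ y) :
    Real.exp (-y) ≤ 1 - y + 1 / 2 * y ^ (2 : ℝ) := by
  have h1 := Real.quadratic_le_exp_of_nonneg hy
  have h2 : 0 < 1 + y + y ^ 2 / 2 := by positivity
  rw [Real.rpow_two, Real.exp_neg]
  calc (Real.exp y)⁻¹ ≤ (1 + y + y ^ 2 / 2)⁻¹ := by gcongr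
    _ ≤ _ := by
      rw [inv_le_iff_one_le_mul₀ h2]
      nlinarith [sq_nonneg (y ^ 2)]

theorem exp_neg_le_rpow {q y : ℝ} (hq1 : 1 ≤ q) (hq2 : q ≤ 2) (hy : 0 ≤ y) :
    Real.exp (-y) ≤ 1 - y + 1 * y ^ q := by
  rw [one_mul]
  rcases le_total y 1 with hy1 | hy1
  · have h1 := exp_neg_le_quadratic hy
    rcases hy.eq_or_lt with rfl | hy0
    · simp [Real.zero_rpow (show q ≠ 0 by linarith)]
    have h2 := Real.rpow_le_rpow_of_exponent_ge hy0 hy1 hq2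
    have h3 : 0 ≤ y ^ (2 : ℝ) := Real.rpow_nonneg hy _
    linarith
  · have h1 : Real.exp (-y) ≤ 1 := Real.exp_le_one_iff.2 (by linarith)
    have h2 : y ≤ y ^ q := Real.self_le_rpow_of_one_le hy1 hq1
    linarith

variable {Z : Type*} [MeasurableSpace Z] {μ : Measure Z} [IsProbabilityMeasure μ]
  {X : Z → ℝ} {m B : ℝ}

theorem integrable_rpow_of_lintegral_le (hX : Measurable X) (hX0 : ∀ z, 0 ≤ X z)
    (hmom : ∫⁻ z, ENNReal.ofReal (X z ^ m) ∂μ ≤ ENNReal.ofReal (B ^ m)) :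
    Integrable (fun z => X z ^ m) μ := by
  refine ⟨(hX.pow_const m).aestronglyMeasurable, ?_⟩
  rw [hasFiniteIntegral_iff_ofReal (Filter.Eventually.of_forall fun z =>
    Real.rpow_nonneg (hX0 z) m)]
  exact hmom.trans_lt ENNReal.ofReal_lt_top

theorem integral_rpow_le (hX : Measurable X) (hX0 : ∀ z, 0 ≤ X z) (hB : 0 ≤ B)
    (hmom : ∫⁻ z, ENNReal.ofReal (X z ^ m) ∂μ ≤ ENNReal.ofReal (B ^ m)) :
    ∫ z, X z ^ m ∂μ ≤ B ^ m := by
  have h := ofReal_integral_eq_lintegral_ofReal (integrable_rpow_of_lintegral_le hX hX0 hmom)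
    (Filter.Eventually.of_forall fun z => Real.rpow_nonneg (hX0 z) m)
  rw [← h] at hmom
  exact (ENNReal.ofReal_le_ofReal_iff (Real.rpow_nonneg hB _)).1 hmom

theorem le_one_add_rpow {x : ℝ} (hm : 1 ≤ m) (hx : 0 ≤ x) : x ≤ 1 + x ^ m := by
  rcases le_total x 1 with h | h
  · have := Real.rpow_nonneg hx m
    linarith
  · have := Real.self_le_rpow_of_one_le h hm
    linarith

theorem integrable_of_lintegral_rpow_le (hm : 1 ≤ m) (hX : Measurable X) (hX0 : ∀ z, 0 ≤ X z)
    (hmom : ∫⁻ z, ENNReal.ofReal (X z ^ m) ∂μ ≤ ENNReal.ofReal (B ^ m)) :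
    Integrable X μ :=
  ((integrable_const 1).add (integrable_rpow_of_lintegral_le hX hX0 hmom)).mono'
    hX.aestronglyMeasurable (Filter.Eventually.of_forall fun z => by
      rw [Real.norm_of_nonneg (hX0 z)]
      exact le_one_add_rpow hm (hX0 z))

theorem integral_le_one_add_rpow (hm : 1 ≤ m) (hX : Measurable X) (hX0 : ∀ z, 0 ≤ X z)
    (hB : 0 ≤ B) (hmom : ∫⁻ z, ENNReal.ofReal (X z ^ m) ∂μ ≤ ENNReal.ofReal (B ^ m)) :
    ∫ z, X z ∂μ ≤ 1 + B ^ m := by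
  have hi := integrable_rpow_of_lintegral_le hX hX0 hmom
  calc ∫ z, X z ∂μ ≤ ∫ z, (1 + X z ^ m) ∂μ :=
        integral_mono (integrable_of_lintegral_rpow_le hm hX hX0 hmom)
          ((integrable_const 1).add hi) fun z => le_one_add_rpow hm (hX0 z)
    _ = 1 + ∫ z, X z ^ m ∂μ := by rw [integral_add (integrable_const 1) hi]; simp
    _ ≤ _ := by linarith [integral_rpow_le hX hX0 hB hmom]

/-- One-sided sub-gaussian-type bound for a nonnegative variable with a bounded moment. -/
theorem lintegral_exp_integral_sub_le {κ lam : ℝ} (hm : 1 ≤ m)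
    (hexp : ∀ y : ℝ, 0 ≤ y → Real.exp (-y) ≤ 1 - y + κ * y ^ m) (hκ : 0 ≤ κ)
    (hX : Measurable X) (hX0 : ∀ z, 0 ≤ X z) (hB : 0 ≤ B)
    (hmom : ∫⁻ z, ENNReal.ofReal (X z ^ m) ∂μ ≤ ENNReal.ofReal (B ^ m)) (hlam : 0 ≤ lam) :
    ∫⁻ z, ENNReal.ofReal (Real.exp (lam * (∫ z', X z' ∂μ - X z))) ∂μ ≤
      ENNReal.ofReal (Real.exp (κ * lam ^ m * B ^ m)) := by
  set R := ∫ z', X z' ∂μ with hR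
  have hi := integrable_rpow_of_lintegral_le hX hX0 hmom
  have hiX := integrable_of_lintegral_rpow_le hm hX hX0 hmom
  have hpt : ∀ z, Real.exp (lam * (R - X z)) ≤
      Real.exp (lam * R) * (1 - lam * X z + κ * lam ^ m * X z ^ m) := fun z => by
    have h := hexp (lam * X z) (mul_nonneg hlam (hX0 z))
    rw [Real.mul_rpow hlam (hX0 z)] at h
    rw [mul_sub, sub_eq_add_neg, Real.exp_add]
    refine mul_le_mul_of_nonneg_left ?_ (Real.exp_nonneg _)
    linarith
  have hint : Integrable (fun z => 1 - lam * X z + κ * lam ^ m * X z ^ m) μ :=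
    ((integrable_const 1).sub (hiX.const_mul lam)).add (hi.const_mul _)
  have heq : ∫ z, (1 - lam * X z + κ * lam ^ m * X z ^ m) ∂μ =
      1 - lam * R + κ * lam ^ m * ∫ z, X z ^ m ∂μ := by
    have h1 : Integrable (fun z => 1 - lam * X z) μ :=
      (integrable_const 1).sub (hiX.const_mul lam)
    rw [integral_add h1 (hi.const_mul _), integral_sub (integrable_const 1) (hiX.const_mul lam), integral_const_mul,
      integral_const_mul]
    simp [hR]
  calc _ ≤ ∫⁻ z, ENNReal.ofReal
        (Real.exp (lam * R) * (1 - lam * X z + κ * lam ^ m * X z ^ m)) ∂μ :=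
        lintegral_mono fun z => ENNReal.ofReal_le_ofReal (hpt z)
    _ = ENNReal.ofReal (∫ z, Real.exp (lam * R) *
        (1 - lam * X z + κ * lam ^ m * X z ^ m) ∂μ) := by
        rw [ofReal_integral_eq_lintegral_ofReal (hint.const_mul _)]
        exact Filter.Eventually.of_forall fun z => (Real.exp_nonneg _).trans (hpt z)
    _ ≤ _ := by
        refine ENNReal.ofReal_le_ofReal ?_
        rw [integral_const_mul, heq]
        have h1 := integral_rpow_le hX hX0 hB hmom
        have h2 : κ * lam ^ m * ∫ z, X z ^ m ∂μ ≤ κ * lam ^ m * B ^ m := by gcongr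
        -- Applying `1 + u ≤ exp u` to the expectation cancels the prefactor `exp (lam * R)`.
        have h3 := Real.add_one_le_exp (-(lam * R) + κ * lam ^ m * B ^ m)
        calc _ ≤ Real.exp (lam * R) * Real.exp (-(lam * R) + κ * lam ^ m * B ^ m) := by
              gcongr; linarith
          _ = _ := by rw [← Real.exp_add]; congr 1; ring

end MomentGenerating

/-! ### Jensen's inequality against a density -/

section Jensen

variable {W : Type*} [MeasurableSpace W] {P₁ : Measure W}

theorem ofReal_integral_le_lintegral_ofReal {f : W → ℝ} (hf : Integrable f P₁) :
    ENNReal.ofReal (∫ w, f w ∂P₁) ≤ ∫⁻ w, ENNReal.ofReal (f w) ∂P₁ := by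
  have h1 : ∫ w, f w ∂P₁ ≤ ∫ w, max (f w) 0 ∂P₁ :=
    integral_mono hf hf.pos_part fun w => le_max_left _ _
  calc _ ≤ ENNReal.ofReal (∫ w, max (f w) 0 ∂P₁) := ENNReal.ofReal_le_ofReal h1
    _ = ∫⁻ w, ENNReal.ofReal (max (f w) 0) ∂P₁ :=
      ofReal_integral_eq_lintegral_ofReal hf.pos_part
        (Filter.Eventually.of_forall fun w => le_max_right _ _)
    _ = _ := by simp

/-- Jensen's inequality for the exponential, with respect to a density. -/
theorem ofReal_exp_integral_mul_le {f g : W → ℝ} (hg0 : 0 ≤ᵐ[P₁] g) (hg : Integrable g P₁)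
    (hg1 : ∫ w, g w ∂P₁ = 1) (hfg : Integrable (fun w => f w * g w) P₁) (lam : ℝ) :
    ENNReal.ofReal (Real.exp (lam * ∫ w, f w * g w ∂P₁)) ≤
      ∫⁻ w, ENNReal.ofReal (g w) * ENNReal.ofReal (Real.exp (lam * f w)) ∂P₁ := by
  set A := ∫ w, f w * g w ∂P₁ with hA
  -- The integrand is the tangent line of `exp` at the mean, weighted by `g`. It is integrable even
  -- when `exp (lam * f)` is not, so the right-hand side may be infinite.
  have hi : Integrable (fun w => Real.exp (lam * A) *
      ((1 - lam * A) * g w + lam * (f w * g w))) P₁ :=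
    ((hg.const_mul _).add (hfg.const_mul _)).const_mul _
  have heq : ∫ w, Real.exp (lam * A) * ((1 - lam * A) * g w + lam * (f w * g w)) ∂P₁ =
      Real.exp (lam * A) := by
    rw [integral_const_mul, integral_add (hg.const_mul _) (hfg.const_mul _), integral_const_mul,
      integral_const_mul, hg1, ← hA]
    ring
  rw [← heq]
  refine (ofReal_integral_le_lintegral_ofReal hi).trans (lintegral_mono_ae ?_)
  filter_upwards [hg0] with w hw
  rw [← ENNReal.ofReal_mul hw]
  refine ENNReal.ofReal_le_ofReal ?_
  have h1 := Real.add_one_le_exp (lam * f w - lam * A)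
  have h2 : Real.exp (lam * f w) = Real.exp (lam * A) * Real.exp (lam * f w - lam * A) := by
    rw [← Real.exp_add]; congr 1; ring
  calc Real.exp (lam * A) * ((1 - lam * A) * g w + lam * (f w * g w)) =
        g w * (Real.exp (lam * A) * (lam * f w - lam * A + 1)) := by ring
    _ ≤ g w * (Real.exp (lam * A) * Real.exp (lam * f w - lam * A)) := by gcongr
    _ = _ := by rw [h2]

end Jensen

/-! ### Measurability and exponential moments of the loss functionals -/

section Risk

variable {W Z : Type*} [MeasurableSpace W] [MeasurableSpace Z] {μ : Measure Z}
  [IsProbabilityMeasure μ] {ℓ : W → Z → ℝ} {P₁ : Measure W} [IsProbabilityMeasure P₁]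
  {m B : ℝ} {a b : ℝ≥0∞}

theorem measurable_risk (hℓ : Measurable (Function.uncurry ℓ)) : Measurable (risk ℓ μ) :=
  (hℓ.stronglyMeasurable.integral_prod_right).measurable

theorem memLp_risk (hℓ : Measurable (Function.uncurry ℓ)) (hℓ0 : ∀ w z, 0 ≤ ℓ w z) (hm : 1 ≤ m)
    (hB : 0 ≤ B)
    (hmom : ∀ w, ∫⁻ z, ENNReal.ofReal (ℓ w z ^ m) ∂μ ≤ ENNReal.ofReal (B ^ m)) :
    MemLp (risk ℓ μ) b P₁ := by
  refine MemLp.of_bound (measurable_risk hℓ).aestronglyMeasurable (1 + B ^ m)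
    (Filter.Eventually.of_forall fun w => ?_)
  rw [Real.norm_of_nonneg (show 0 ≤ risk ℓ μ w from integral_nonneg (hℓ0 w))]
  exact integral_le_one_add_rpow hm hℓ.of_uncurry_left (hℓ0 w) hB (hmom w)

theorem measurable_eLpNorm_section (hℓ : Measurable (Function.uncurry ℓ)) (hb0 : b ≠ 0)
    (hb : b ≠ ∞) : Measurable fun z => eLpNorm (fun w => ℓ w z) b P₁ := by
  simp only [eLpNorm_eq_lintegral_rpow_enorm_toReal hb0 hb]
  refine Measurable.pow_const (Measurable.lintegral_prod_left ?_) _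
  exact (hℓ.enorm.pow_const b.toReal)

theorem memLp_section_iff (hℓ : Measurable (Function.uncurry ℓ)) (z : Z) :
    MemLp (fun w => ℓ w z) b P₁ ↔ eLpNorm (fun w => ℓ w z) b P₁ ≠ ∞ :=
  ⟨fun h => h.2.ne, fun h => ⟨hℓ.of_uncurry_right.aestronglyMeasurable, h.lt_top⟩⟩

variable [Fact (1 ≤ a)] [Fact (1 ≤ b)] [ENNReal.HolderConjugate b a]

theorem measurable_pairing_section (hℓ : Measurable (Function.uncurry ℓ)) (hb0 : b ≠ 0)
    (hb : b ≠ ∞) (g : Lp ℝ a P₁) :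
    Measurable fun z => pairing P₁ a b (fun w => ℓ w z) g := by
  classical
  have heq : (fun z => pairing P₁ a b (fun w => ℓ w z) g) =
      {z | eLpNorm (fun w => ℓ w z) b P₁ ≠ ∞}.indicator fun z => ∫ w, ℓ w z * g w ∂P₁ := by
    ext z
    by_cases hz : eLpNorm (fun w => ℓ w z) b P₁ ≠ ∞
    · rw [Set.indicator_of_mem (show z ∈ {z | eLpNorm (fun w => ℓ w z) b P₁ ≠ ∞} from hz),
        pairing_apply ((memLp_section_iff hℓ z).2 hz)]
    · rw [Set.indicator_of_notMem (show z ∉ {z | eLpNorm (fun w => ℓ w z) b P₁ ≠ ∞} from hz),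
        pairing_of_not_memLp (mt (memLp_section_iff hℓ z).1 hz)]
      rfl
  rw [heq]
  refine Measurable.indicator ?_
    ((measurable_eLpNorm_section hℓ hb0 hb) (measurableSet_singleton ∞)).compl
  refine (StronglyMeasurable.integral_prod_left ?_).measurable
  exact (hℓ.mul ((Lp.stronglyMeasurable g).measurable.comp measurable_fst)).stronglyMeasurable

/-- Jensen moves the exponential inside the average over `g`, Tonelli exchanges the integrals, and
the moment bound is uniform in `w` while `g` has mass one. Off the restricted set the pairing takes
its default value `0`, so the integral formula is unavailable there. -/
theorem lintegral_exp_pairing_le {κ lam : ℝ} (hℓ : Measurable (Function.uncurry ℓ))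
    (hℓ0 : ∀ w z, 0 ≤ ℓ w z) (hm : 1 ≤ m)
    (hexp : ∀ y : ℝ, 0 ≤ y → Real.exp (-y) ≤ 1 - y + κ * y ^ m) (hκ : 0 ≤ κ) (hB : 0 ≤ B)
    (hmom : ∀ w, ∫⁻ z, ENNReal.ofReal (ℓ w z ^ m) ∂μ ≤ ENNReal.ofReal (B ^ m)) (hlam : 0 ≤ lam)
    (hb0 : b ≠ 0) (hb : b ≠ ∞) {g : Lp ℝ a P₁} (hg : g ∈ densities P₁ a) :
    ∫⁻ z in {z | eLpNorm (fun w => ℓ w z) b P₁ ≠ ∞}, ENNReal.ofReal (Real.exp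
      (lam * (pairing P₁ a b (risk ℓ μ) g - pairing P₁ a b (fun w => ℓ w z) g))) ∂μ ≤
      ENNReal.ofReal (Real.exp (κ * lam ^ m * B ^ m)) := by
  have hset : MeasurableSet {z | eLpNorm (fun w => ℓ w z) b P₁ ≠ ∞} :=
    ((measurable_eLpNorm_section hℓ hb0 hb) (measurableSet_singleton ∞)).compl
  have hgi : Integrable g P₁ := (Lp.memLp g).integrable Fact.out
  have hgm : Measurable g := (Lp.stronglyMeasurable g).measurable
  have hrisk : MemLp (risk ℓ μ) b P₁ := memLp_risk hℓ hℓ0 hm hB hmom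
  have hjm : Measurable fun x : Z × W => ENNReal.ofReal (g x.2) *
      ENNReal.ofReal (Real.exp (lam * (risk ℓ μ x.2 - ℓ x.2 x.1))) := by
    have h1 : Measurable fun x : Z × W => ℓ x.2 x.1 := hℓ.comp measurable_swap
    have h2 : Measurable fun x : Z × W => risk ℓ μ x.2 := (measurable_risk hℓ).comp measurable_snd
    exact (hgm.comp measurable_snd).ennreal_ofReal.mul
      (Real.measurable_exp.comp ((h2.sub h1).const_mul lam)).ennreal_ofReal
  calc _ ≤ ∫⁻ z in {z | eLpNorm (fun w => ℓ w z) b P₁ ≠ ∞}, ∫⁻ w, ENNReal.ofReal (g w) *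
        ENNReal.ofReal (Real.exp (lam * (risk ℓ μ w - ℓ w z))) ∂P₁ ∂μ := by
        refine setLIntegral_mono' hset fun z hz => ?_
        have hz' : MemLp (fun w => ℓ w z) b P₁ := (memLp_section_iff hℓ z).2 hz
        have h1 := integrable_mul_of_memLp hrisk g
        have h2 := integrable_mul_of_memLp hz' g
        rw [pairing_apply hrisk, pairing_apply hz', ← integral_sub h1 h2]
        simp only [← sub_mul]
        refine ofReal_exp_integral_mul_le hg.1 hgi hg.2 ?_ lam
        simp only [sub_mul]
        exact h1.sub h2
    _ ≤ ∫⁻ z, ∫⁻ w, ENNReal.ofReal (g w) *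
        ENNReal.ofReal (Real.exp (lam * (risk ℓ μ w - ℓ w z))) ∂P₁ ∂μ :=
        setLIntegral_le_lintegral _ _
    _ = ∫⁻ w, ∫⁻ z, ENNReal.ofReal (g w) *
        ENNReal.ofReal (Real.exp (lam * (risk ℓ μ w - ℓ w z))) ∂μ ∂P₁ :=
        lintegral_lintegral_swap hjm.aemeasurable
    _ ≤ ∫⁻ w, ENNReal.ofReal (g w) * ENNReal.ofReal (Real.exp (κ * lam ^ m * B ^ m)) ∂P₁ := by
        refine lintegral_mono fun w => ?_
        have hw : Measurable (ℓ w) := hℓ.of_uncurry_left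
        rw [lintegral_const_mul]
        · gcongr
          exact lintegral_exp_integral_sub_le hm hexp hκ hw (hℓ0 w) hB (hmom w) hlam
        · exact (Real.measurable_exp.comp ((measurable_const.sub hw).const_mul
            lam)).ennreal_ofReal
    _ = _ := by
        rw [lintegral_mul_const _ hgm.ennreal_ofReal,
          ← ofReal_integral_eq_lintegral_ofReal hgi hg.1, hg.2, ENNReal.ofReal_one, one_mul]

end Risk

/-! ### Reduction to a countably generated σ-algebra on `W` -/

section CountablyGenerated

variable {W Z : Type*} [mW : MeasurableSpace W] [mZ : MeasurableSpace Z]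

/-- The sets with this property contain the rectangles and form a σ-algebra: a countable union of
countable families is countable. -/
theorem exists_countable_measurableSet_prod {s : Set (W × Z)} (hs : MeasurableSet s) :
    ∃ b : Set (Set W), b.Countable ∧ (∀ u ∈ b, MeasurableSet u) ∧
      MeasurableSet[(MeasurableSpace.generateFrom b).prod mZ] s := by
  have hmono : ∀ {b b' : Set (Set W)}, b ⊆ b' → ∀ {s : Set (W × Z)},
      MeasurableSet[(MeasurableSpace.generateFrom b).prod mZ] s →
      MeasurableSet[(MeasurableSpace.generateFrom b').prod mZ] s := fun hbb _ h =>
    sup_le_sup_right (MeasurableSpace.comap_mono (MeasurableSpace.generateFrom_mono hbb)) _ _ h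
  rw [← generateFrom_prod] at hs
  induction s, hs using MeasurableSpace.generateFrom_induction with
  | hC t ht _ =>
    obtain ⟨u, hu, v, hv, rfl⟩ := ht
    refine ⟨{u}, Set.countable_singleton u, by simpa using hu, ?_⟩
    exact @MeasurableSet.prod _ _ (MeasurableSpace.generateFrom {u}) mZ _ _
      (MeasurableSpace.measurableSet_generateFrom (Set.mem_singleton u)) hv
  | empty => exact ⟨∅, Set.countable_empty, by simp, @MeasurableSet.empty _ (_)⟩
  | compl t _ ih =>
    obtain ⟨b, hb, hbm, h⟩ := ih
    exact ⟨b, hb, hbm, h.compl⟩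
  | iUnion s _ ih =>
    choose b hb hbm h using ih
    refine ⟨⋃ i, b i, Set.countable_iUnion hb, ?_, ?_⟩
    · intro u hu
      obtain ⟨i, hi⟩ := Set.mem_iUnion.1 hu
      exact hbm i u hi
    · exact MeasurableSet.iUnion fun i => hmono (Set.subset_iUnion b i) (h i)

theorem exists_countablyGenerated_measurable_uncurry {ℓ : W → Z → ℝ}
    (hℓ : Measurable (Function.uncurry ℓ)) :
    ∃ m : MeasurableSpace W, m ≤ mW ∧ @MeasurableSpace.CountablyGenerated W m ∧
      @Measurable _ _ (m.prod mZ) _ (Function.uncurry ℓ) := by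
  choose b hb hbm h using fun x : ℚ =>
    exists_countable_measurableSet_prod (hℓ (measurableSet_Iio (a := (x : ℝ))))
  refine ⟨MeasurableSpace.generateFrom (⋃ x, b x), MeasurableSpace.generateFrom_le ?_,
    @MeasurableSpace.CountablyGenerated.mk W (MeasurableSpace.generateFrom _)
      ⟨_, Set.countable_iUnion hb, rfl⟩, ?_⟩
  · intro u hu
    obtain ⟨i, hi⟩ := Set.mem_iUnion.1 hu
    exact hbm i u hi
  · rw [BorelSpace.measurable_eq (α := ℝ), Real.borel_eq_generateFrom_Iio_rat]
    refine @measurable_generateFrom _ _ (_) _ _ fun t ht => ?_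
    obtain ⟨x, hx⟩ := Set.mem_iUnion.1 ht
    rw [Set.mem_singleton_iff.1 hx]
    exact sup_le_sup_right (MeasurableSpace.comap_mono
      (MeasurableSpace.generateFrom_mono (Set.subset_iUnion b x))) _ _ (h x)

end CountablyGenerated

/-! ### From the potential to the generalization error -/

section GeneralizationBound

variable {Z : Type*} [MeasurableSpace Z] {μ : Measure Z} [IsProbabilityMeasure μ]
  {p q r r' m κ lam B η δ K₀ : ℝ}

theorem exists_event_integral_gen_le_of_countablyGenerated {W : Type*} [MeasurableSpace W]
    [MeasurableSpace.CountablyGenerated W] {P₁ : Measure W} [IsProbabilityMeasure P₁]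
    {ℓ : W → Z → ℝ} [Fact (1 ≤ ENNReal.ofReal p)]
    (hℓ : Measurable (Function.uncurry ℓ)) (hℓ0 : ∀ w z, 0 ≤ ℓ w z) (hpq : p.HolderConjugate q)
    (hr : r.HolderConjugate r') (hm : 1 ≤ m)
    (hexp : ∀ y : ℝ, 0 ≤ y → Real.exp (-y) ≤ 1 - y + κ * y ^ m) (hκ : 0 ≤ κ) (hB : 0 ≤ B)
    (hmom : ∀ w, ∫⁻ z, ENNReal.ofReal (ℓ w z ^ m) ∂μ ≤ ENNReal.ofReal (B ^ m))
    (hlam : 0 < lam) (hη : 0 < η) (hδ : 0 < δ) (hK₀ : 0 ≤ K₀)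
    (huc : ∀ K > K₀, ∃ c > 0, NormRpowUniformConvex (Lp ℝ (ENNReal.ofReal p) P₁) r c ∧
      1 / r' * (η / (r * c)) ^ (r' - 1) ≤ K) {n : ℕ} (hn : 0 < n) :
    ∃ E : Set (Fin n → Z), MeasurableSet E ∧
      ENNReal.ofReal (1 - δ) ≤ Measure.pi (fun _ : Fin n => μ) E ∧
      ∀ S ∈ E, (∀ t, eLpNorm (fun w => ℓ w (S t)) (ENNReal.ofReal q) P₁ ≠ ∞) →
      ∀ P : Measure W, IsProbabilityMeasure P → P ≪ P₁ →
        eLpNorm (fun w => (P.rnDeriv P₁ w).toReal - 1) (ENNReal.ofReal p) P₁ ≠ ∞ →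
        ∫ w, gen ℓ μ S w ∂P ≤
          (eLpNorm (fun w => (P.rnDeriv P₁ w).toReal - 1) (ENNReal.ofReal p) P₁).toReal ^ r
            / (η * n) +
          K₀ / n * ∑ t, (eLpNorm (fun w => ℓ w (S t)) (ENNReal.ofReal q) P₁).toReal ^ r' +
          (n * (κ * lam ^ m * B ^ m) + Real.log (1 / δ)) / (lam * n) := by
  set a := ENNReal.ofReal p with ha
  set b := ENNReal.ofReal q with hb
  have ha' : a ≠ ∞ := ENNReal.ofReal_ne_top
  have hb' : b ≠ ∞ := ENNReal.ofReal_ne_top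
  have hb0 : b ≠ 0 := by simpa [hb] using hpq.symm.pos
  have : Fact (1 ≤ b) := ⟨by simpa [hb] using hpq.symm.lt.le⟩
  -- Together with countable generation, `a ≠ ∞` makes `Lp ℝ a P₁` second countable, as
  -- measurability of the potential requires.
  have : Fact (a ≠ ∞) := ⟨ha'⟩
  have : ENNReal.HolderConjugate b a := hpq.symm.ennrealOfReal
  set e : Lp ℝ a P₁ := (memLp_const (1 : ℝ)).toLp (fun _ => (1 : ℝ)) with he
  have hemem : e ∈ densities P₁ a := toLp_one_mem_densities
  set ρ := pairing P₁ a b (risk ℓ μ) with hρ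
  set ψ : Z → StrongDual ℝ (Lp ℝ a P₁) := fun z => pairing P₁ a b (fun w => ℓ w z) with hψ
  set N : Z → ℝ≥0∞ := fun z => eLpNorm (fun w => ℓ w z) b P₁ with hN
  have hNm : Measurable N := measurable_eLpNorm_section hℓ hb0 hb'
  have hψm : ∀ g, Measurable fun z => ψ z g := measurable_pairing_section hℓ hb0 hb'
  have hrisk : MemLp (risk ℓ μ) b P₁ := memLp_risk hℓ hℓ0 hm hB hmom
  set bad : Set (Fin n → Z) := {S | (∀ t, N (S t) ≠ ∞) ∧
      n * (κ * lam ^ m * B ^ m) + Real.log (1 / δ) <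
        lam * (potential (densities P₁ a) e r η (∑ t, (ρ - ψ (S t)))
        - K₀ * ∑ t, (N (S t)).toReal ^ r')} with hbad
  have hbadle : Measure.pi (fun _ : Fin n => μ) bad ≤ ENNReal.ofReal δ := by
    refine measure_potential_gt_le_of_forall_gt hr hη hemem hψm hNm
      (fun z hz => norm_pairing_le ((memLp_section_iff hℓ z).2 hz)) hK₀ hlam hδ ?_
      (fun g hg => lintegral_exp_pairing_le hℓ hℓ0 hm hexp hκ hB hmom hlam.le hb0 hb' hg) n
    intro K hK ε hε φ
    obtain ⟨c, hc, huc, hcK⟩ := huc K hK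
    obtain ⟨g, hg, h⟩ := exists_potential_add_sub_le hr hη hemem convex_densities hc huc hε φ ρ
    refine ⟨g, hg, fun ψ' => (h ψ').trans ?_⟩
    gcongr
  have hbadm : MeasurableSet bad := by
    have h1 : Measurable fun S : Fin n → Z =>
        potential (densities P₁ a) e r η (∑ t, (ρ - ψ (S t))) := by
      simpa using measurable_potential_add_sum (ρ := ρ) hr hη hemem hψm n 0
    have h2 : ∀ t, Measurable fun S : Fin n → Z => N (S t) := fun t =>
      hNm.comp (measurable_pi_apply t)
    have h3 : Measurable fun S : Fin n → Z => ∑ t, (N (S t)).toReal ^ r' :=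
      Finset.measurable_sum _ fun t _ => (h2 t).ennreal_toReal.pow_const r'
    have h4 : MeasurableSet {S : Fin n → Z | ∀ t, N (S t) ≠ ∞} := by
      have : {S : Fin n → Z | ∀ t, N (S t) ≠ ∞} = ⋂ t, {S | N (S t) ≠ ∞} := by
        ext S; simp
      rw [this]
      exact MeasurableSet.iInter fun t => ((h2 t) (measurableSet_singleton ∞)).compl
    exact h4.inter (measurableSet_lt measurable_const ((h1.sub (h3.const_mul K₀)).const_mul lam))
  refine ⟨badᶜ, hbadm.compl, ?_, ?_⟩
  · rw [prob_compl_eq_one_sub hbadm, ENNReal.ofReal_sub _ hδ.le, ENNReal.ofReal_one]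
    exact tsub_le_tsub_left hbadle 1
  intro S hS hfin P hP hPP₁ hdist
  set f : W → ℝ := fun w => (P.rnDeriv P₁ w).toReal with hf
  have hfm : Measurable f := (Measure.measurable_rnDeriv P P₁).ennreal_toReal
  have hf1 : MemLp (fun w => f w - 1) a P₁ :=
    ⟨(hfm.sub_const 1).aestronglyMeasurable, lt_top_iff_ne_top.2 hdist⟩
  have hfL : MemLp f a P₁ := by
    have := hf1.add (memLp_const (1 : ℝ))
    refine this.ae_eq (Filter.Eventually.of_forall fun w => ?_)
    simp
  set g : Lp ℝ a P₁ := hfL.toLp f with hg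
  have hgf : g =ᵐ[P₁] f := hfL.coeFn_toLp
  have hgmem : g ∈ densities P₁ a := by
    refine ⟨?_, ?_⟩
    · filter_upwards [hgf] with w hw
      rw [hw]
      exact ENNReal.toReal_nonneg
    · rw [integral_congr_ae hgf, Measure.integral_toReal_rnDeriv hPP₁]
      simp
  have hnorm : ‖g - e‖ = (eLpNorm (fun w => f w - 1) a P₁).toReal := by
    rw [hg, he, ← MemLp.toLp_sub, Lp.norm_toLp]
    rfl
  have hnR : (0 : ℝ) < n := by exact_mod_cast hn
  have hgen : (∑ t, (ρ - ψ (S t))) g = n * ∫ w, gen ℓ μ S w ∂P := by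
    have hi : ∀ t, Integrable (fun w => ℓ w (S t) * g w) P₁ := fun t =>
      integrable_mul_of_memLp ((memLp_section_iff hℓ (S t)).2 (hfin t)) g
    have h1 : ∫ w, gen ℓ μ S w ∂P = ∫ w, (risk ℓ μ w * g w
        - 1 / n * ∑ t, ℓ w (S t) * g w) ∂P₁ := by
      rw [← integral_rnDeriv_smul hPP₁]
      refine integral_congr_ae ?_
      filter_upwards [hgf] with w hw
      rw [hw, ← Finset.sum_mul]
      simp only [gen, empRisk, smul_eq_mul, hf]
      ring
    rw [h1, integral_sub (integrable_mul_of_memLp hrisk g)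
      ((integrable_finsetSum _ fun t _ => hi t).const_mul _), integral_const_mul,
      integral_finsetSum _ fun t _ => hi t]
    simp only [sum_apply, sub_apply, Finset.sum_sub_distrib]
    rw [hρ, pairing_apply hrisk, Finset.sum_congr rfl fun t _ =>
      pairing_apply ((memLp_section_iff hℓ (S t)).2 (hfin t)) g]
    simp only [Finset.sum_const, Finset.card_univ, Fintype.card_fin, nsmul_eq_mul]
    field_simp
  have hnot : lam * (potential (densities P₁ a) e r η (∑ t, (ρ - ψ (S t)))
        - K₀ * ∑ t, (N (S t)).toReal ^ r') ≤ n * (κ * lam ^ m * B ^ m) + Real.log (1 / δ) := by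
    by_contra h
    exact hS ⟨hfin, not_le.1 h⟩
  have hpot := le_potential (e := e) hr hη (∑ t, (ρ - ψ (S t))) hgmem
  rw [hgen, hnorm] at hpot
  have h2 : potential (densities P₁ a) e r η (∑ t, (ρ - ψ (S t))) ≤
      K₀ * ∑ t, (N (S t)).toReal ^ r' +
        (n * (κ * lam ^ m * B ^ m) + Real.log (1 / δ)) / lam := by
    rw [← sub_le_iff_le_add', le_div_iff₀ hlam]
    linarith
  have h3 : (n : ℝ) * ∫ w, gen ℓ μ S w ∂P ≤
      (eLpNorm (fun w => f w - 1) a P₁).toReal ^ r / η + (K₀ * ∑ t, (N (S t)).toReal ^ r' +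
        (n * (κ * lam ^ m * B ^ m) + Real.log (1 / δ)) / lam) := by linarith
  have h4 := div_le_div_of_nonneg_right h3 hnR.le
  rw [mul_div_cancel_left₀ _ hnR.ne'] at h4
  refine h4.trans_eq ?_
  field_simp
  ring

/-- The generalization bound for an abstract exponent: the hypothesis space is replaced by one with
a countably generated σ-algebra, for which the potential is measurable. -/
theorem exists_event_integral_gen_le {W : Type*} [mW : MeasurableSpace W] {P₁ : Measure W}
    [IsProbabilityMeasure P₁] {ℓ : W → Z → ℝ} [Fact (1 ≤ ENNReal.ofReal p)]
    (hℓ : Measurable (Function.uncurry ℓ)) (hℓ0 : ∀ w z, 0 ≤ ℓ w z) (hpq : p.HolderConjugate q)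
    (hr : r.HolderConjugate r') (hm : 1 ≤ m)
    (hexp : ∀ y : ℝ, 0 ≤ y → Real.exp (-y) ≤ 1 - y + κ * y ^ m) (hκ : 0 ≤ κ) (hB : 0 ≤ B)
    (hmom : ∀ w, ∫⁻ z, ENNReal.ofReal (ℓ w z ^ m) ∂μ ≤ ENNReal.ofReal (B ^ m))
    (hlam : 0 < lam) (hη : 0 < η) (hδ : 0 < δ) (hK₀ : 0 ≤ K₀)
    (huc : ∀ (mW' : MeasurableSpace W) (P₁' : @Measure W mW') (K : ℝ), K > K₀ →
      ∃ c > 0, NormRpowUniformConvex (Lp ℝ (ENNReal.ofReal p) P₁') r c ∧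
      1 / r' * (η / (r * c)) ^ (r' - 1) ≤ K) {n : ℕ} (hn : 0 < n) :
    ∃ E : Set (Fin n → Z), MeasurableSet E ∧
      ENNReal.ofReal (1 - δ) ≤ Measure.pi (fun _ : Fin n => μ) E ∧
      ∀ S ∈ E, (∀ t, eLpNorm (fun w => ℓ w (S t)) (ENNReal.ofReal q) P₁ ≠ ∞) →
      ∀ P : Measure W, IsProbabilityMeasure P → P ≪ P₁ →
        eLpNorm (fun w => (P.rnDeriv P₁ w).toReal - 1) (ENNReal.ofReal p) P₁ ≠ ∞ →
        ∫ w, gen ℓ μ S w ∂P ≤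
          (eLpNorm (fun w => (P.rnDeriv P₁ w).toReal - 1) (ENNReal.ofReal p) P₁).toReal ^ r
            / (η * n) +
          K₀ / n * ∑ t, (eLpNorm (fun w => ℓ w (S t)) (ENNReal.ofReal q) P₁).toReal ^ r' +
          (n * (κ * lam ^ m * B ^ m) + Real.log (1 / δ)) / (lam * n) := by
  obtain ⟨mW', hle, hcg, hℓ'⟩ := exists_countablyGenerated_measurable_uncurry hℓ
  have hprob : ∀ P : @Measure W mW, @IsProbabilityMeasure W mW P →
      @IsProbabilityMeasure W mW' (P.trim hle) := fun P hP =>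
    ⟨by rw [trim_measurableSet_eq hle (@MeasurableSet.univ W mW')]; exact hP.measure_univ⟩
  have hP₁' := hprob P₁ inferInstance
  obtain ⟨E, hE, hEδ, h⟩ := @exists_event_integral_gen_le_of_countablyGenerated Z _ μ _ p q r r' m
    κ lam B η δ K₀ W mW' hcg (P₁.trim hle) hP₁' ℓ _ hℓ' hℓ0 hpq hr hm hexp hκ hB hmom hlam hη hδ
    hK₀ (huc mW' (P₁.trim hle)) n hn
  have hsec : ∀ z, StronglyMeasurable[mW'] fun w => ℓ w z := fun z =>
    (@Measurable.of_uncurry_right _ _ _ mW' _ _ ℓ hℓ' z).stronglyMeasurable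
  have hN : ∀ z, eLpNorm (fun w => ℓ w z) (ENNReal.ofReal q) (P₁.trim hle) =
      eLpNorm (fun w => ℓ w z) (ENNReal.ofReal q) P₁ := fun z => eLpNorm_trim hle (hsec z)
  refine ⟨E, hE, hEδ, fun S hS hfin P hP hPP₁ hdist => ?_⟩
  have hgen : StronglyMeasurable[mW'] (gen ℓ μ S) := by
    have h1 : Measurable[mW'] (risk ℓ μ) := @measurable_risk W Z mW' _ μ _ ℓ hℓ'
    have h2 : Measurable[mW'] (empRisk ℓ S) :=
      (Finset.measurable_sum _ fun t _ => (hsec (S t)).measurable).const_mul _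
    exact (h1.sub h2).stronglyMeasurable
  -- The density of the trimmed measures is a conditional expectation, which contracts `L^p`;
  -- trimming can only decrease the distance to `P₁`.
  have hd : eLpNorm (fun w => ((P.trim hle).rnDeriv (P₁.trim hle) w).toReal - 1)
      (ENNReal.ofReal p) (P₁.trim hle) ≤
      eLpNorm (fun w => (P.rnDeriv P₁ w).toReal - 1) (ENNReal.ofReal p) P₁ := by
    have h1 : StronglyMeasurable[mW']
        (fun w => ((P.trim hle).rnDeriv (P₁.trim hle) w).toReal - 1) := by
      exact (((@Measure.measurable_rnDeriv W mW' _ _).ennreal_toReal).sub_const 1).stronglyMeasurable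
    rw [eLpNorm_trim hle h1]
    have h2 := ae_eq_of_ae_eq_trim (toReal_rnDeriv_trim hle hPP₁)
    have h3 := condExp_sub (μ := P₁) (Measure.integrable_toReal_rnDeriv (μ := P) (ν := P₁))
      (integrable_const (1 : ℝ)) mW'
    rw [condExp_const hle] at h3
    have h4 : (fun w => ((P.trim hle).rnDeriv (P₁.trim hle) w).toReal - 1) =ᵐ[P₁]
        P₁[(fun w => (P.rnDeriv P₁ w).toReal) - (fun _ => (1 : ℝ)) | mW'] := by
      filter_upwards [h2, h3] with w h2 h3
      rw [h3, h2]
      rfl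
    rw [eLpNorm_congr_ae h4]
    exact eLpNorm_condExp_le_eLpNorm _ Fact.out
  have hmain := h S hS (fun t => by rw [hN]; exact hfin t) (P.trim hle) (hprob P hP)
    (hPP₁.trim hle) (ne_top_of_le_ne_top hdist hd)
  rw [← integral_trim hle hgen] at hmain
  simp only [hN] at hmain
  refine hmain.trans ?_
  have hr0 : 0 ≤ r := hr.nonneg
  have hnR : (0 : ℝ) < n := by exact_mod_cast hn
  gcongr

end GeneralizationBound

/-! ### Passing to extended-real bounds -/

section Conversion

theorem lpDist_eq_of_absolutelyContinuous {W : Type*} [MeasurableSpace W] {P₁ P : Measure W}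
    [SigmaFinite P₁] {p : ℝ} (h : P ≪ P₁) :
    lpDist p P₁ P P₁ = eLpNorm (fun w => (P.rnDeriv P₁ w).toReal - 1) (ENNReal.ofReal p) P₁ := by
  rw [lpDist, if_pos ⟨h, Measure.AbsolutelyContinuous.rfl⟩]
  refine eLpNorm_congr_ae ?_
  filter_upwards [Measure.rnDeriv_self P₁] with w hw
  rw [hw, ENNReal.toReal_one]

theorem absolutelyContinuous_of_lpDist_ne_top {W : Type*} [MeasurableSpace W] {P₁ P : Measure W}
    {p : ℝ} (h : lpDist p P₁ P P₁ ≠ ∞) : P ≪ P₁ := by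
  by_contra hP
  exact h (if_neg fun h' => hP h'.1)

/-- An infinite distance or dual norm makes the right-hand side infinite, since `c` is finite and
`k` positive; only the finite case needs a proof. -/
theorem coe_le_ennreal_of_toReal {n : ℕ} {D : ℝ≥0∞} {N : Fin n → ℝ≥0∞} {x r r' c k T : ℝ}
    (hr : 0 < r) (hr' : 0 < r') (hc : 0 < c) (hk : 0 < k) (hT : 0 ≤ T)
    (h : D ≠ ∞ → (∀ t, N t ≠ ∞) →
      x ≤ D.toReal ^ r / c + k * ∑ t, (N t).toReal ^ r' + T) :
    (x : EReal) ≤ ((D ^ r / ENNReal.ofReal c + ENNReal.ofReal k * ∑ t, N t ^ r'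
      + ENNReal.ofReal T : ℝ≥0∞) : EReal) := by
  by_cases hD : D = ∞
  · have : D ^ r / ENNReal.ofReal c = ∞ := by
      rw [hD, ENNReal.top_rpow_of_pos hr, ENNReal.top_div_of_ne_top ENNReal.ofReal_ne_top]
    rw [this]
    simp
  by_cases hN : ∀ t, N t ≠ ∞
  · have hD' : D ^ r / ENNReal.ofReal c = ENNReal.ofReal (D.toReal ^ r / c) := by
      rw [ENNReal.ofReal_div_of_pos hc, ← ENNReal.ofReal_rpow_of_nonneg ENNReal.toReal_nonneg hr.le,
        ENNReal.ofReal_toReal hD]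
    have hN' : ∑ t, N t ^ r' = ENNReal.ofReal (∑ t, (N t).toReal ^ r') := by
      rw [ENNReal.ofReal_sum_of_nonneg fun t _ => by positivity]
      refine Finset.sum_congr rfl fun t _ => ?_
      rw [← ENNReal.ofReal_rpow_of_nonneg ENNReal.toReal_nonneg hr'.le,
        ENNReal.ofReal_toReal (hN t)]
    have h0 : 0 ≤ ∑ t, (N t).toReal ^ r' := Finset.sum_nonneg fun t _ => by positivity
    have h1 : 0 ≤ D.toReal ^ r / c := by positivity
    rw [hD', hN', ← ENNReal.ofReal_mul hk.le, ← ENNReal.ofReal_add h1 (by positivity),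
      ← ENNReal.ofReal_add (by positivity) hT, EReal.coe_ennreal_ofReal, EReal.coe_le_coe_iff]
    exact (h hD hN).trans (le_max_left _ _)
  · push Not at hN
    obtain ⟨t, ht⟩ := hN
    have hs : ∑ t, N t ^ r' = ∞ :=
      ENNReal.sum_eq_top.2 ⟨t, Finset.mem_univ t, by rw [ht, ENNReal.top_rpow_of_pos hr']⟩
    rw [hs, ENNReal.mul_top (by simpa using hk)]
    simp

end Conversion

/-! ### Choice of `λ` and of the convexity constant -/

section Tuning

theorem quadratic_tuning {B L n : ℝ} (hB : 0 < B) (hL : 0 < L) (hn : 0 < n) :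
    (n * (1 / 2 * (Real.sqrt (2 * L / n) / B) ^ (2 : ℝ) * B ^ (2 : ℝ)) + L) /
      (Real.sqrt (2 * L / n) / B * n) = Real.sqrt (2 * B ^ 2 * L / n) := by
  have h1 : Real.sqrt (2 * B ^ 2 * L / n) = B * Real.sqrt (2 * L / n) := by
    rw [show 2 * B ^ 2 * L / n = B ^ 2 * (2 * L / n) by ring, Real.sqrt_mul (sq_nonneg B),
      Real.sqrt_sq hB.le]
  have h2 : 0 < Real.sqrt (2 * L / n) := Real.sqrt_pos.2 (by positivity)
  have h3 : Real.sqrt (2 * L / n) ^ 2 = 2 * L / n := Real.sq_sqrt (by positivity)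
  have h4 : L = n / 2 * Real.sqrt (2 * L / n) ^ 2 := by rw [h3]; field_simp
  rw [h1, Real.rpow_two, Real.rpow_two]
  generalize Real.sqrt (2 * L / n) = s at *
  rw [h4]
  field_simp
  ring

theorem rpow_tuning {q B L n : ℝ} (hq : 1 < q) (hB : 0 < B) (hL : 0 < L) (hn : 0 < n) :
    (n * (1 * ((L / n) ^ (1 / q) / B) ^ q * B ^ q) + L) / ((L / n) ^ (1 / q) / B * n) =
      2 * B * (L / n) ^ (1 - 1 / q) := by
  have hx : 0 < L / n := by positivity
  have h1 : ((L / n) ^ (1 / q) / B) ^ q * B ^ q = L / n := by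
    rw [← Real.mul_rpow (by positivity) hB.le, div_mul_cancel₀ _ hB.ne', ← Real.rpow_mul hx.le,
      one_div_mul_cancel (by linarith), Real.rpow_one]
  rw [one_mul, h1, Real.rpow_sub hx, Real.rpow_one]
  have : 0 < (L / n) ^ (1 / q) := by positivity
  field_simp
  ring

theorem sqrt_le_two_mul_rpow {B L n : ℝ} (hB : 0 < B) (hL : 0 < L) (hn : 0 < n) :
    Real.sqrt (2 * B ^ 2 * L / n) ≤ 2 * B * (L / n) ^ (1 - 1 / (2 : ℝ)) := by
  rw [show (1 - 1 / (2 : ℝ)) = 1 / 2 by norm_num, ← Real.sqrt_eq_rpow]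
  have hx : 0 < L / n := by positivity
  refine Real.sqrt_le_iff.2 ⟨by positivity, ?_⟩
  rw [mul_pow, Real.sq_sqrt hx.le, mul_div_assoc]
  nlinarith [mul_pos (pow_pos hB 2) hx]

/-- At the limit `c = 2 ^ (2 - p)` the stability constant equals the stated one, because `(p - 1) *
(q - 1) = 1`. Continuity in `c` then provides an admissible `c` below the limit for every larger
`K`. -/
theorem exists_normRpowUniformConvex_of_gt {W : Type*} [MeasurableSpace W] (P₁ : Measure W)
    {p q η K : ℝ} [Fact (1 ≤ ENNReal.ofReal p)] (hpq : p.HolderConjugate q) (hp : 2 ≤ p)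
    (hη : 0 < η) (hK : 2 / q * (η / (2 * p)) ^ (q - 1) < K) :
    ∃ c > 0, NormRpowUniformConvex (Lp ℝ (ENNReal.ofReal p) P₁) p c ∧
      1 / q * (η / (p * c)) ^ (q - 1) ≤ K := by
  have hp0 : 0 < p := by linarith
  have hq0 : 0 < q := hpq.symm.pos
  have hc0 : (0 : ℝ) < 2 ^ (2 - p) := by positivity
  have hval : 1 / q * (η / (p * 2 ^ (2 - p))) ^ (q - 1) = 2 / q * (η / (2 * p)) ^ (q - 1) := by
    have h1 : η / (p * 2 ^ (2 - p)) = 2 ^ (p - 1) * (η / (2 * p)) := by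
      have h2 : (2 : ℝ) ^ (p - 1) * 2 ^ (2 - p) = 2 := by
        rw [← Real.rpow_add (by norm_num)]
        norm_num
      rw [div_eq_iff (by positivity)]
      calc η = 2 * (η / (2 * p)) * p := by field_simp
        _ = 2 ^ (p - 1) * 2 ^ (2 - p) * (η / (2 * p)) * p := by rw [h2]
        _ = _ := by ring
    rw [h1, Real.mul_rpow (by positivity) (by positivity), ← Real.rpow_mul (by norm_num),
      show (p - 1) * (q - 1) = 1 by linarith [hpq.mul_eq_add], Real.rpow_one]
    ring
  have hcont : ContinuousAt (fun c : ℝ => 1 / q * (η / (p * c)) ^ (q - 1)) (2 ^ (2 - p)) := by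
    refine continuousAt_const.mul (ContinuousAt.rpow_const ?_ (Or.inr ?_))
    · exact continuousAt_const.div (by fun_prop) (by positivity)
    · linarith [hpq.symm.lt]
  have h1 : ∀ᶠ c in nhdsWithin ((2 : ℝ) ^ (2 - p)) (Set.Iio (2 ^ (2 - p))),
      1 / q * (η / (p * c)) ^ (q - 1) < K :=
    (hcont.tendsto.mono_left nhdsWithin_le_nhds).eventually (gt_mem_nhds (by rw [hval]; exact hK))
  obtain ⟨c, hcK, hc⟩ := (h1.and (Ioo_mem_nhdsLT hc0)).exists
  exact ⟨c, hc.1, normRpowUniformConvex_of_two_le hp hc.2, hcK.le⟩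

end Tuning

/-! ### The bound in terms of `genBar` -/

section FinalBound

variable {W Z : Type*} [MeasurableSpace W] [MeasurableSpace Z]
    {μ : Measure Z} [IsProbabilityMeasure μ] {ℓ : W → Z → ℝ} {p q r r' m κ lam B η δ K₀ : ℝ}
    {P₁ : Measure W} [IsProbabilityMeasure P₁]

theorem exists_event_genBar_le [Fact (1 ≤ ENNReal.ofReal p)]
    (hℓ : Measurable (Function.uncurry ℓ)) (hℓ0 : ∀ w z, 0 ≤ ℓ w z) (hpq : p.HolderConjugate q)
    (hr : r.HolderConjugate r') (hm : 1 ≤ m)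
    (hexp : ∀ y : ℝ, 0 ≤ y → Real.exp (-y) ≤ 1 - y + κ * y ^ m) (hκ : 0 ≤ κ) (hB : 0 ≤ B)
    (hmom : ∀ w, ∫⁻ z, ENNReal.ofReal (ℓ w z ^ m) ∂μ ≤ ENNReal.ofReal (B ^ m))
    (hlam : 0 < lam) (hη : 0 < η) (hδ : 0 < δ) (hK₀ : 0 ≤ K₀)
    (huc : ∀ (mW' : MeasurableSpace W) (P₁' : @Measure W mW') (K : ℝ), K > K₀ →
      ∃ c > 0, NormRpowUniformConvex (Lp ℝ (ENNReal.ofReal p) P₁') r c ∧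
      1 / r' * (η / (r * c)) ^ (r' - 1) ≤ K) {n : ℕ} (hn : 0 < n) {K₁ T : ℝ}
    (hT : (n * (κ * lam ^ m * B ^ m) + Real.log (1 / δ)) / (lam * n) ≤ T) (hK₁ : K₀ / n ≤ K₁) :
    ∃ E : Set (Fin n → Z), MeasurableSet E ∧
      ENNReal.ofReal (1 - δ) ≤ Measure.pi (fun _ : Fin n => μ) E ∧
      ∀ S ∈ E, ∀ A : LearningAlgorithm n W Z, lpDist p P₁ (A S) P₁ ≠ ∞ →
        (∀ t, dualNorm q P₁ (fun w => ℓ w (S t)) ≠ ∞) →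
        genBar ℓ μ A S ≤ (lpDist p P₁ (A S) P₁).toReal ^ r / (η * n) +
          K₁ * ∑ t, (dualNorm q P₁ (fun w => ℓ w (S t))).toReal ^ r' + T := by
  obtain ⟨E, hE, hEδ, h⟩ := exists_event_integral_gen_le (P₁ := P₁) hℓ hℓ0 hpq hr hm hexp hκ hB
    hmom hlam hη hδ hK₀ huc hn
  refine ⟨E, hE, hEδ, fun S hS A hD hN => ?_⟩
  have hac := absolutelyContinuous_of_lpDist_ne_top hD
  rw [lpDist_eq_of_absolutelyContinuous hac] at hD ⊢
  refine (h S hS hN (A S) inferInstance hac hD).trans ?_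
  have h0 : 0 ≤ ∑ t, (dualNorm q P₁ (fun w => ℓ w (S t))).toReal ^ r' :=
    Finset.sum_nonneg fun t _ => by positivity
  have h1 := mul_le_mul_of_nonneg_right hK₁ h0
  exact add_le_add (by simpa [dualNorm] using h1) hT

end FinalBound

end OnlineToPAC

/-! ### The theorem: the cases `p < 2`, `p = 2` and `p > 2` -/

open OnlineToPAC in
theorem mainTheorem9 {W Z : Type*} [MeasurableSpace W] [MeasurableSpace Z]
    (μ : Measure Z) [IsProbabilityMeasure μ]
    (ℓ : W → Z → ℝ) (hℓm : Measurable (Function.uncurry ℓ)) (hℓ0 : ∀ w z, 0 ≤ ℓ w z)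
    (p q : ℝ) (hp : 1 < p) (hpq : 1 / p + 1 / q = 1)
    (B : ℝ) (hB : 0 < B)
    (hmom : (⨆ w, ∫⁻ z, ENNReal.ofReal (ℓ w z ^ min 2 q) ∂μ) ≤ ENNReal.ofReal (B ^ min 2 q))
    (P₁ : Measure W) [IsProbabilityMeasure P₁]
    (n : ℕ) (hn : 1 < n) (η : ℝ) (hη : 0 < η) (δ : ℝ) (hδ0 : 0 < δ) (hδ1 : δ < 1) :
    ∃ E : Set (Fin n → Z), MeasurableSet E ∧
      ENNReal.ofReal (1 - δ) ≤ Measure.pi (fun _ : Fin n => μ) E ∧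
      ∀ S ∈ E, ∀ A : OnlineToPAC.LearningAlgorithm n W Z,
        (p ≤ 2 →
          ((OnlineToPAC.genBar ℓ μ A S : ℝ) : EReal) ≤
            ((OnlineToPAC.lpDist p P₁ (A S) P₁ ^ 2 / ENNReal.ofReal (η * n)
              + ENNReal.ofReal (η / ((p - 1) * n)) *
                  ∑ t, OnlineToPAC.dualNorm q P₁ (fun w => ℓ w (S t)) ^ 2
              + ENNReal.ofReal (Real.sqrt (2 * B ^ 2 * Real.log (1 / δ) / n)) : ℝ≥0∞) : EReal)) ∧
        (2 ≤ p →
          ((OnlineToPAC.genBar ℓ μ A S : ℝ) : EReal) ≤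
            ((OnlineToPAC.lpDist p P₁ (A S) P₁ ^ p / ENNReal.ofReal (η * n)
              + ENNReal.ofReal (2 / (q * n) * (η / (2 * p)) ^ (q - 1)) *
                  ∑ t, OnlineToPAC.dualNorm q P₁ (fun w => ℓ w (S t)) ^ q
              + ENNReal.ofReal (2 * B * (Real.log (1 / δ) / n) ^ (1 - 1 / q)) : ℝ≥0∞) :
                EReal)) := by
  have hpq' : p.HolderConjugate q :=
    Real.holderConjugate_iff.2 ⟨hp, by simpa [one_div] using hpq⟩
  have hq1 : 1 < q := hpq'.symm.lt
  have hmul : (p - 1) * (q - 1) = 1 := by linarith [hpq'.mul_eq_add]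
  have hmom' : ∀ w, ∫⁻ z, ENNReal.ofReal (ℓ w z ^ min 2 q) ∂μ ≤ ENNReal.ofReal (B ^ min 2 q) :=
    fun w => (le_iSup (fun w => ∫⁻ z, ENNReal.ofReal (ℓ w z ^ min 2 q) ∂μ) w).trans hmom
  have : Fact (1 ≤ ENNReal.ofReal p) := ⟨by simpa using hp.le⟩
  have h22 : (2 : ℝ).HolderConjugate 2 := Real.holderConjugate_iff.2 ⟨by norm_num, by norm_num⟩
  have hn0 : 0 < n := by omega
  have hnR : (0 : ℝ) < n := by exact_mod_cast hn0
  have hL : 0 < Real.log (1 / δ) := Real.log_pos (by rw [lt_div_iff₀ hδ0]; linarith)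
  have hηn : 0 < η * n := by positivity
  have hlam2 : 0 < Real.sqrt (2 * Real.log (1 / δ) / n) / B :=
    div_pos (Real.sqrt_pos.2 (by positivity)) hB
  rcases lt_trichotomy p 2 with hp2 | rfl | hp2
  · have hq2 : 2 ≤ q := by nlinarith
    rw [min_eq_left hq2] at hmom'
    have hp0 : 0 < p - 1 := by linarith
    obtain ⟨E, hE, hEδ, h⟩ := exists_event_genBar_le (P₁ := P₁) (m := 2) (K₀ := η / (p - 1))
      hℓm hℓ0 hpq' h22 (by norm_num) (fun y hy => exp_neg_le_quadratic hy) (by norm_num) hB.le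
      hmom' hlam2 hη hδ0 (by positivity) (fun mW' P₁' K hK => ⟨(p - 1) / 2, by positivity,
        normRpowUniformConvex_two hp hp2.le, by
          -- Midpoint convexity, `θ = 1 / 2`, yields only `c = (p - 1) / 2`; its stability constant
          -- is still half of what is allowed.
          have : 1 / 2 * (η / (2 * ((p - 1) / 2))) ^ ((2 : ℝ) - 1) = η / (p - 1) / 2 := by
            norm_num
            field_simp
          have h0 : 0 < η / (p - 1) := by positivity
          linarith⟩) hn0 (quadratic_tuning hB hL hnR).le (div_div η (p - 1) n).le
    refine ⟨E, hE, hEδ, fun S hS A => ⟨fun _ => ?_, fun h2 => absurd hp2 (not_lt.2 h2)⟩⟩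
    have := coe_le_ennreal_of_toReal two_pos two_pos hηn (by positivity) (Real.sqrt_nonneg _)
      (h S hS A)
    simpa only [ENNReal.rpow_two] using this
  · obtain rfl : q = 2 := by linarith
    rw [min_self] at hmom'
    -- At `p = 2` one event must serve both bounds. It is built from the smaller dual-norm
    -- coefficient, that of (b), and the smaller deviation term, that of (a).
    have hK : (2 : ℝ) / (2 * n) * (η / (2 * 2)) ^ ((2 : ℝ) - 1) = η / (4 * n) := by
      norm_num
      field_simp
    obtain ⟨E, hE, hEδ, h⟩ := exists_event_genBar_le (P₁ := P₁) (m := 2)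
      (K₀ := 2 / 2 * (η / (2 * 2)) ^ ((2 : ℝ) - 1)) (K₁ := η / (4 * n))
      hℓm hℓ0 h22 h22 (by norm_num) (fun y hy => exp_neg_le_quadratic hy) (by norm_num) hB.le
      hmom' hlam2 hη hδ0 (by positivity)
      (fun mW' P₁' K hK => exists_normRpowUniformConvex_of_gt P₁' h22 le_rfl hη hK) hn0
      (quadratic_tuning hB hL hnR).le (by rw [← hK]; exact le_of_eq (by ring))
    refine ⟨E, hE, hEδ, fun S hS A => ⟨fun _ => ?_, fun _ => ?_⟩⟩
    · have := coe_le_ennreal_of_toReal (k := η / ((2 - 1) * n)) two_pos two_pos hηn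
        (by norm_num; positivity) (Real.sqrt_nonneg _) fun hD hN => (h S hS A hD hN).trans (by
          gcongr
          norm_num)
      simpa only [ENNReal.rpow_two] using this
    · rw [hK]
      exact coe_le_ennreal_of_toReal two_pos two_pos hηn (by positivity) (by positivity)
        fun hD hN => (h S hS A hD hN).trans (by
          gcongr
          exact sqrt_le_two_mul_rpow hB hL hnR)
  · have hq2 : q ≤ 2 := by nlinarith
    rw [min_eq_right hq2] at hmom'
    have hq0 : 0 < q := by linarith
    have hp0 : 0 < p := by linarith
    obtain ⟨E, hE, hEδ, h⟩ := exists_event_genBar_le (P₁ := P₁) (m := q)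
      (K₀ := 2 / q * (η / (2 * p)) ^ (q - 1)) (K₁ := 2 / (q * n) * (η / (2 * p)) ^ (q - 1))
      (lam := (Real.log (1 / δ) / n) ^ (1 / q) / B)
      hℓm hℓ0 hpq' hpq' hq1.le (fun y hy => exp_neg_le_rpow hq1.le hq2 hy) zero_le_one hB.le
      hmom' (by positivity) hη hδ0 (by positivity)
      (fun mW' P₁' K hK => exists_normRpowUniformConvex_of_gt P₁' hpq' hp2.le hη hK) hn0
      (rpow_tuning hq1 hB hL hnR).le (le_of_eq (by field_simp))
    refine ⟨E, hE, hEδ, fun S hS A => ⟨fun h2 => absurd hp2 (not_lt.2 h2), fun _ => ?_⟩⟩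
    exact coe_le_ennreal_of_toReal hp0 hq0 hηn (by positivity) (by positivity) (h S hS A)
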